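/- Let $\alpha>0$ and $0<\delta<b$. Let $\tilde\gamma$ be the line $\operatorname{Re} z=b$ oriented upwards, and let $\gamma$ be the contour that comes from $-\infty-i\delta$ along a horizontal ray to $-i\delta$, follows the right half of the circle $|z|=\delta$ to $i\delta$, and returns along a horizontal ray to $-\infty+i\delta$ (so $\gamma$ encircles the poles $0,-1,-2,\dots$ of $\Gamma$ counterclockwise and is disjoint from $\tilde\gamma$). For $x,y\in\mathbb R$ let $$K_{\mathrm{crit}}(x,y)=\frac1{(2\pi i)^2}\int_{\tilde\gamma}ds\int_{\gamma}dt\,\frac{\Gamma(t)}{\Gamma(s)}\,\frac{e^{\alpha s^2/2-ys}}{e^{\alpha t^2/2-xt}}\,\frac1{s-t}$$ be the critical kernel. Let $\mathscr X$ be a determinantal point process on $\mathbb R$ with correlation kernel $K_{\mathrm{crit}}$ with respect to Lebesgue measure (the critical determinantal process), and for $a>0$ let $$\mathcal P(a)=\mathbb P\big[\mathscr X\cap(a,+\infty)=\varnothing\big]$$ be its gap probability. **Theorem.** For every $a>0$, the kernel $$Q_a(x,y)=\frac{1_{\tilde\gamma}(x)1_\gamma(y)\,\Gamma(y)\,e^{\frac{\alpha(x^2-y^2)}4-a(x-y)}-1_\gamma(x)1_{\tilde\gamma}(y)\,\frac1{\Gamma(y)}\,e^{-\frac{\alpha(x^2-y^2)}4}}{2\pi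 i\,(x-y)},\qquad x,y\in\gamma\cup\tilde\gamma,$$ with the convention $Q_a(x,x)=0$, defines through $(\mathrm Q_af)(x)=\int_{\gamma\cup\tilde\gamma}Q_a(x,y)f(y)\,dy$ (where $dy$ is the complex line element) a trace-class operator $\mathrm Q_a$ on $L^2(\gamma\cup\tilde\gamma,|dz|)$, and its Fredholm determinant satisfies $$\mathcal P(a)=\det(I-\mathrm Q_a).$$ Moreover, the series $$1+\sum_{n\ge1}\frac{(-1)^n}{n!}\int_{(a,\infty)^n}\det\big(K_{\mathrm{crit}}(x_j,x_k)\big)_{j,k=1}^n\,dx_1\cdots dx_n,$$ whose integrals and sum converge absolutely and which expresses $\mathcal P(a)$, equals $\det(I-\mathrm Q_a)$. -/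

import Mathlib

open MeasureTheory Filter Topology
open scoped ENNReal NNReal

noncomputable section

/-! ### Trace-class operators and Fredholm determinants -/

section Operators

variable {H : Type} [NormedAddCommGroup H] [InnerProductSpace ℂ H]

/-- A bounded operator on a Hilbert space is of trace class (equivalently, nuclear) if it is a sum
`T f = ∑ₙ ⟪uₙ, f⟫ vₙ` of rank-one operators with `∑ₙ ‖uₙ‖ ‖vₙ‖ < ∞`. -/
def IsTraceClass (T : H →L[ℂ] H) : Prop :=
  ∃ u v : ℕ → H, Summable (fun n => ‖u n‖ * ‖v n‖) ∧
    ∀ f : H, HasSum (fun n => inner ℂ (u n) f • v n) (T f)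

open Classical in
/-- The finite section `det (δᵢⱼ - ⟪eᵢ, T eⱼ⟫)_{i, j ∈ s}` of `I - T` in an orthonormal basis. -/
def sectionDet {ι : Type} (e : HilbertBasis ι ℂ H) (T : H →L[ℂ] H) (s : Finset ι) : ℂ :=
  (1 - Matrix.of fun i j : s => inner ℂ (e i) (T (e j))).det

/-- `T` is of trace class and `d = det (I - T)`: the Fredholm determinant is the limit of the
determinants of the finite sections of `I - T`, in every orthonormal (Hilbert) basis. -/
def HasFredholmDet (T : H →L[ℂ] H) (d : ℂ) : Prop :=
  IsTraceClass T ∧ ∀ (ι : Type) (e : HilbertBasis ι ℂ H),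
    Tendsto (sectionDet e T) atTop (𝓝 d)

end Operators

/-! ### The contours -/

/-- Unit-speed parametrization of the contour `γ`: it comes from `-∞ - iδ` along a horizontal ray
to `-iδ`, follows the right half of the circle `|z| = δ` to `iδ`, and returns along a horizontal
ray to `-∞ + iδ`; so it encircles the non-positive integers counterclockwise. -/
def gammaPath (δ : ℝ) (r : ℝ) : ℂ :=
  if r ≤ -(Real.pi * δ / 2) then ((r + Real.pi * δ / 2 : ℝ) : ℂ) - δ * Complex.I
  else if r ≤ Real.pi * δ / 2 then δ * Complex.exp ((r / δ : ℝ) * Complex.I)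
  else ((Real.pi * δ / 2 - r : ℝ) : ℂ) + δ * Complex.I

/-- Unit-speed parametrization of the contour `γ̃`: the line `Re z = b`, oriented upwards. -/
def gammaTildePath (b : ℝ) (r : ℝ) : ℂ := b + r * Complex.I

/-- The contour `γ` as a subset of the plane. -/
def gammaSet (δ : ℝ) : Set ℂ := Set.range (gammaPath δ)

/-- The contour `γ̃` as a subset of the plane. -/
def gammaTildeSet (b : ℝ) : Set ℂ := Set.range (gammaTildePath b)

/-- The contour integral `∫_c f(z) dz` along a curve `c`. -/
def contourIntegral (c : ℝ → ℂ) (f : ℂ → ℂ) : ℂ := ∫ r : ℝ, f (c r) * deriv c r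

/-- Absolute convergence of `∫_c f(z) dz`. -/
def ContourIntegrable (c : ℝ → ℂ) (f : ℂ → ℂ) : Prop := Integrable fun r : ℝ => f (c r) * deriv c r

/-- Arc length `|dz|` on `γ ∪ γ̃`. -/
def arcLength (δ b : ℝ) : Measure ℂ :=
  (volume : Measure ℝ).map (gammaPath δ) + (volume : Measure ℝ).map (gammaTildePath b)

/-- The Hilbert space `L²(γ ∪ γ̃, |dz|)`. -/
abbrev ContourL2 (δ b : ℝ) : Type := Lp ℂ 2 (arcLength δ b)

/-- `T` is the integral operator `(T f)(x) = ∫_{γ ∪ γ̃} k(x, y) f(y) dy` on `L²(γ ∪ γ̃)`, where `dy`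
is the complex line element of the oriented contours. -/
def IsContourIntegralOperator (δ b : ℝ) (k : ℂ → ℂ → ℂ)
    (T : ContourL2 δ b →L[ℂ] ContourL2 δ b) : Prop :=
  ∀ f : ContourL2 δ b, ∀ᵐ x ∂(arcLength δ b),
    ContourIntegrable (gammaPath δ) (fun y => k x y * f y) ∧
    ContourIntegrable (gammaTildePath b) (fun y => k x y * f y) ∧
    T f x = contourIntegral (gammaPath δ) (fun y => k x y * f y)
      + contourIntegral (gammaTildePath b) (fun y => k x y * f y)

/-! ### The kernels -/

/-- The critical kernel
`(2πi)⁻² ∫_γ̃ ds ∫_γ dt Γ(t)/Γ(s) · exp(αs²/2 - ys)/exp(αt²/2 - xt) · 1/(s - t)`. -/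
def critKernel (α δ b : ℝ) (x y : ℝ) : ℂ :=
  1 / (2 * Real.pi * Complex.I) ^ 2 *
    contourIntegral (gammaTildePath b) fun s =>
      contourIntegral (gammaPath δ) fun t =>
        Complex.Gamma t / Complex.Gamma s *
          (Complex.exp (α * s ^ 2 / 2 - y * s) / Complex.exp (α * t ^ 2 / 2 - x * t)) *
          (1 / (s - t))

/-- The integrable kernel `Q_a(x, y)` on `γ ∪ γ̃`. On the diagonal the numerator vanishes, and the
value is `0`. -/
def integrableKernel (α δ b a : ℝ) (x y : ℂ) : ℂ :=
  ((gammaTildeSet b).indicator 1 x * (gammaSet δ).indicator 1 y * Complex.Gamma y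
        * Complex.exp (α * (x ^ 2 - y ^ 2) / 4 - a * (x - y))
      - (gammaSet δ).indicator 1 x * (gammaTildeSet b).indicator 1 y * (Complex.Gamma y)⁻¹
        * Complex.exp (-(α * (x ^ 2 - y ^ 2) / 4)))
    / (2 * Real.pi * Complex.I * (x - y))

/-! ### Determinantal point processes on the line -/

section PointProcess

variable {Ω : Type*} [MeasurableSpace Ω]

/-- A (simple) point process on `ℝ`: a random locally finite subset of `ℝ`, for which the number of
particles in each Borel set is a random variable. -/
structure IsPointProcess (X : Ω → Set ℝ) : Prop where
  locallyFinite : ∀ (ω : Ω) (C : Set ℝ), IsCompact C → (X ω ∩ C).Finite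
  measurable_count : ∀ A : Set ℝ, MeasurableSet A → Measurable fun ω => (X ω ∩ A).encard

/-- `ρ` is the `n`-th correlation function of `X` with respect to Lebesgue measure: the expected
number of `n`-tuples of distinct particles of `X` lying in a Borel set `B ⊆ ℝⁿ` is `∫_B ρ`. -/
def IsCorrelationFunction (P : Measure Ω) (X : Ω → Set ℝ) (n : ℕ) (ρ : (Fin n → ℝ) → ℝ≥0) : Prop :=
  Measurable ρ ∧ ∀ B : Set (Fin n → ℝ), MeasurableSet B →
    ∫⁻ ω, ({x : Fin n → ℝ | x.Injective ∧ (∀ i, x i ∈ X ω) ∧ x ∈ B}.encard : ℝ≥0∞) ∂P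
      = ∫⁻ x in B, (ρ x : ℝ≥0∞)

/-- `X` is a determinantal point process on `ℝ` with correlation kernel `K`: for every `n`,
`det (K(xⱼ, xₖ))` is (almost everywhere) its `n`-th correlation function. -/
structure IsDeterminantalProcess (P : Measure Ω) (X : Ω → Set ℝ) (K : ℝ → ℝ → ℂ) : Prop where
  isPointProcess : IsPointProcess X
  correlation : ∀ n : ℕ, ∃ ρ : (Fin n → ℝ) → ℝ≥0, IsCorrelationFunction P X n ρ ∧
    ∀ᵐ x : Fin n → ℝ, ((ρ x : ℝ) : ℂ) = (Matrix.of fun j k => K (x j) (x k)).det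

/-- The gap probability: the probability that `X` has no particles in `(a, ∞)`. -/
def gapProbability (P : Measure Ω) (X : Ω → Set ℝ) (a : ℝ) : ℝ :=
  P.real {ω | X ω ∩ Set.Ioi a = ∅}

end PointProcess

/-- `d = 1 + ∑_{n ≥ 1} (-1)ⁿ/n! ∫_{(a, ∞)ⁿ} det (K(xⱼ, xₖ)) dx₁ ⋯ dxₙ`, with all integrals
absolutely convergent (the term `n = 0` of the sum is `1`). -/
def HasFredholmSeries (K : ℝ → ℝ → ℂ) (a : ℝ) (d : ℂ) : Prop :=
  (∀ n : ℕ, IntegrableOn (fun x : Fin n → ℝ => (Matrix.of fun j k => K (x j) (x k)).det)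
    (Set.univ.pi fun _ => Set.Ioi a)) ∧
  HasSum (fun n : ℕ => (-1 : ℂ) ^ n / (n.factorial : ℂ) *
    ∫ x in (Set.univ.pi fun _ : Fin n => Set.Ioi a), (Matrix.of fun j k => K (x j) (x k)).det) d

end

/-!
# The gap probability of the critical determinantal process as a Fredholm determinant

The kernel `Q_a` vanishes on `γ × γ` and on `γ̃ × γ̃`, so that `Q_a` consists of two off-diagonal
blocks `U : L²(γ) → L²(γ̃)` and `V : L²(γ̃) → L²(γ)`, each of which is a Cauchy kernel `1 / (s - t)`
between two weights. The contours are separated by the vertical line `Re z = c`, `c = (δ + b) / 2`,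
and `p = s - c`, `q = c - t` have positive real parts for `s ∈ γ̃`, `t ∈ γ`. The identity
`1 / (2 (p + q)) = ∑ₙ cayley n p * cayley n q`, where `cayley n p = (p - 1)ⁿ / (p + 1)ⁿ⁺¹`
(`hasSum_cayley_mul_cayley`), separates the variables, and `∑ₙ |cayley n p|² = 1 / (4 Re p)` makes
the resulting expansion of `Q_a` into rank-one operators nuclear, because the weights are square
integrable: `Γ` and `1 / Γ` grow at most exponentially along the contours (`exists_norm_Gamma_le`,
`exists_norm_inv_Gamma_le`) while `exp (-α t² / 4)` on `γ` and `exp (α s² / 4)` on `γ̃` decay like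
Gaussians.

For a nuclear operator `∑ₙ ⟪uₙ, ·⟫ vₙ` the determinants of the finite sections converge to the
Fredholm series of the infinite matrix `⟪uᵢ, vⱼ⟫` (`hasFredholmDet_of_hasSum`); Hadamard's
inequality dominates all the series involved. All Fredholm determinants in the proof are compared
through such discrete series:

* the block structure reduces the matrix of `Q_a` to the product of its two off-diagonal blocks
  (`fredholmSum_offDiagonal`), which is `det (1 - Q_a) = det (1 - U V)`;
* since `1 / (s - t) = ∫ₐ^∞ exp (-(x - a) (s - t)) dx`, that product is the matrix of the pairings
  over `(a, ∞)` of Laplace transforms (`integral_laplace_mul_laplace`), which expand the critical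
  kernel as `K(x, y) = ∑ₗ hₗ(x) gₗ(y)`; hence its Fredholm series is the one of `K` on `(a, ∞)`, by
  the identity `det (1 - A B) = det (1 - B A)` in the form `hasSum_fredholm_of_hasSum_mul`. This is
  `hasFredholmSeries_laplace`, and `exists_hasFredholmDet_twoContour` combines the two steps.

Finally, the Fredholm series of the kernel of a determinantal process is its gap probability by
inclusion-exclusion over the particles in `(a, ∞)` (`gapProbability_eq_of_hasFredholmSeries`).
-/

noncomputable section

/-! ### Hadamard's inequality -/

/-- **Hadamard's inequality**: the determinant is bounded by the product of the Euclidean norms of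
the rows. -/
theorem norm_det_le_prod_norm_row {n : ℕ} (M : Matrix (Fin n) (Fin n) ℂ) :
    ‖M.det‖ ≤ ∏ i, ‖(WithLp.toLp 2 (M i) : EuclideanSpace ℂ (Fin n))‖ := by
  set v : Fin n → EuclideanSpace ℂ (Fin n) := fun i => WithLp.toLp 2 (M i)
  have hfr : Module.finrank ℂ (EuclideanSpace ℂ (Fin n)) = Fintype.card (Fin n) := by simp
  set e := EuclideanSpace.basisFun (Fin n) ℂ
  set c := InnerProductSpace.gramSchmidtOrthonormalBasis hfr v
  have h1 : e.toBasis.det v = M.det := by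
    rw [Module.Basis.det_apply, ← Matrix.det_transpose]
    congr 1
  have h2 : e.toBasis.det v = e.toBasis.det c.toBasis * c.toBasis.det v := by
    rw [Module.Basis.det_apply, Module.Basis.det_apply, Module.Basis.det_apply, ← Matrix.det_mul,
      Module.Basis.toMatrix_mul_toMatrix]
  have h3 : ‖e.toBasis.det c.toBasis‖ = 1 := by
    rw [OrthonormalBasis.coe_toBasis]
    exact e.det_to_matrix_orthonormalBasis c
  rw [← h1, h2, norm_mul, h3, one_mul, InnerProductSpace.gramSchmidtOrthonormalBasis_det, norm_prod]
  refine Finset.prod_le_prod (fun _ _ => norm_nonneg _) fun i _ => ?_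
  exact (norm_inner_le_norm _ _).trans (by simp [v])

theorem norm_det_le_of_norm_le_one {n : ℕ} {M : Matrix (Fin n) (Fin n) ℂ}
    (hM : ∀ i j, ‖M i j‖ ≤ 1) : ‖M.det‖ ≤ √n ^ n := by
  refine (norm_det_le_prod_norm_row M).trans ?_
  calc _ ≤ ∏ _i : Fin n, √n := by
        refine Finset.prod_le_prod (fun _ _ => norm_nonneg _) fun i _ => ?_
        rw [EuclideanSpace.norm_eq]
        refine Real.sqrt_le_sqrt ?_
        calc _ ≤ ∑ _j : Fin n, (1 : ℝ) :=
              Finset.sum_le_sum fun j _ => pow_le_one₀ (norm_nonneg _) (hM i j)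
          _ = n := by simp
    _ = _ := by simp

/-- The form of Hadamard's inequality for kernels dominated by a product `A(x) B(y)`. -/
theorem norm_det_le_of_norm_le_mul {n : ℕ} {M : Matrix (Fin n) (Fin n) ℂ} {A B : Fin n → ℝ}
    (hA : ∀ i, 0 ≤ A i) (hB : ∀ i, 0 ≤ B i) (hM : ∀ i j, ‖M i j‖ ≤ A i * B j) :
    ‖M.det‖ ≤ √n ^ n * ∏ i, (A i * B i) := by
  set M' : Matrix (Fin n) (Fin n) ℂ := Matrix.of fun i j => M i j / (A i * B j)
  have h1 : ∀ i j, ‖M' i j‖ ≤ 1 := by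
    intro i j
    simp only [M', Matrix.of_apply, norm_div, norm_mul, Complex.norm_real, Real.norm_eq_abs,
      abs_of_nonneg (hA i), abs_of_nonneg (hB j)]
    exact div_le_one_of_le₀ (hM i j) (mul_nonneg (hA i) (hB j))
  have h2 : M = Matrix.of fun i j => (A i : ℂ) * (Matrix.of fun i j => (B j : ℂ) * M' i j) i j := by
    ext i j
    by_cases h : (A i : ℂ) * B j = 0
    · have h0 : A i * B j = 0 := by exact_mod_cast h
      have := hM i j
      rw [h0] at this
      simp [norm_le_zero_iff.1 this, M']
    · simp only [M', Matrix.of_apply]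
      rw [← mul_assoc, mul_div_cancel₀ _ h]
  rw [h2, Matrix.det_mul_column, Matrix.det_mul_row, Finset.prod_mul_distrib]
  simp only [norm_mul, norm_prod, Complex.norm_real, Real.norm_eq_abs, abs_of_nonneg (hA _),
    abs_of_nonneg (hB _)]
  have := norm_det_le_of_norm_le_one h1
  have hA' : 0 ≤ ∏ i, A i := Finset.prod_nonneg fun i _ => hA i
  have hB' : 0 ≤ ∏ i, B i := Finset.prod_nonneg fun i _ => hB i
  calc _ = ‖M'.det‖ * ((∏ i, A i) * ∏ i, B i) := by ring
    _ ≤ _ := by gcongr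

/-- Hadamard's bound `n ^ (n / 2)` is beaten by the factorial: the Fredholm series is entire. -/
theorem summable_sqrt_pow_mul_pow_div_factorial (C : ℝ) :
    Summable fun n : ℕ => √n ^ n * C ^ n / n.factorial := by
  set ε : ℝ := (2 * Real.exp 1)⁻¹
  have hε : 0 < ε := by positivity
  have h1 : Summable fun n : ℕ => (n : ℝ) ^ n * ε ^ n / n.factorial := by
    refine Summable.of_nonneg_of_le (fun n => by positivity) (fun n => ?_)
      (summable_geometric_of_lt_one (r := 1 / 2) (by norm_num) (by norm_num))
    have := Real.pow_div_factorial_le_exp (n : ℝ) (by positivity) n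
    calc (n : ℝ) ^ n * ε ^ n / n.factorial = (n : ℝ) ^ n / n.factorial * ε ^ n := by ring
      _ ≤ Real.exp n * ε ^ n := by gcongr
      _ = (1 / 2) ^ n := by
        rw [← mul_one (n : ℝ), Real.exp_nat_mul, ← mul_pow]
        congr 1
        simp only [ε]
        field_simp
  have h2 := Real.summable_pow_div_factorial (C ^ 2 / ε)
  -- the arithmetic-geometric mean inequality, balanced by `ε`
  refine Summable.of_norm_bounded ((h1.add h2)) fun n => ?_
  rw [Real.norm_eq_abs, abs_div, Nat.abs_cast, ← add_div]
  gcongr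
  rw [← mul_pow, abs_pow]
  have hp : 0 ≤ n * ε := by positivity
  have hq : 0 ≤ C ^ 2 / ε := by positivity
  have hpq : |√n * C| ^ 2 = (n * ε) * (C ^ 2 / ε) := by
    rw [sq_abs, mul_pow, Real.sq_sqrt (Nat.cast_nonneg n)]
    field_simp
  rcases le_total (n * ε) (C ^ 2 / ε) with h | h
  · have : |√n * C| ≤ C ^ 2 / ε := by
      refine (pow_le_pow_iff_left₀ (abs_nonneg _) (by assumption) two_ne_zero).1 ?_
      rw [hpq]
      exact (mul_le_mul_of_nonneg_right h hq).trans_eq (sq _).symm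
    calc _ ≤ (C ^ 2 / ε) ^ n := by gcongr
      _ ≤ _ := le_add_of_nonneg_left (by positivity)
  · have : |√n * C| ≤ n * ε := by
      refine (pow_le_pow_iff_left₀ (abs_nonneg _) (by assumption) two_ne_zero).1 ?_
      rw [hpq]
      exact (mul_le_mul_of_nonneg_left h hp).trans_eq (sq _).symm
    calc _ ≤ (n * ε) ^ n := by gcongr
      _ = n ^ n * ε ^ n := mul_pow _ _ _
      _ ≤ _ := le_add_of_nonneg_right (by positivity)

/-! ### Fredholm series over a discrete index set -/

/-- The term `(-1)ⁿ/n! det (k(xᵢ, xⱼ))` of the Fredholm series of a matrix `k` at the tuple `x`. -/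
def fredholmTerm {J : Type*} (k : J → J → ℂ) (x : Σ n : ℕ, Fin n → J) : ℂ :=
  (-1) ^ x.1 / x.1.factorial * (Matrix.of fun i j => k (x.2 i) (x.2 j)).det

/-- The Fredholm series `∑ₙ (-1)ⁿ/n! ∑_{x ∈ Jⁿ} det (k(xᵢ, xⱼ))`, that is `det (1 - k)`, of a
possibly infinite matrix `k`, summed over tuples of all lengths at once. -/
def fredholmSum {J : Type*} (k : J → J → ℂ) : ℂ := ∑' x, fredholmTerm k x

/-- The majorant of `fredholmTerm k` given by Hadamard's inequality for `|k(x, y)| ≤ A(x) B(y)`,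
where `c = A B`. -/
def fredholmBound {J : Type*} (c : J → ℝ) (x : Σ n : ℕ, Fin n → J) : ℝ :=
  √x.1 ^ x.1 / x.1.factorial * ∏ i, c (x.2 i)

theorem norm_fredholmTerm_le {J : Type*} {k : J → J → ℂ} {A B : J → ℝ} (hA : ∀ i, 0 ≤ A i)
    (hB : ∀ i, 0 ≤ B i) (hk : ∀ i j, ‖k i j‖ ≤ A i * B j) (x : Σ n : ℕ, Fin n → J) :
    ‖fredholmTerm k x‖ ≤ fredholmBound (fun i => A i * B i) x := by
  have := norm_det_le_of_norm_le_mul (M := Matrix.of fun i j => k (x.2 i) (x.2 j))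
    (fun i => hA (x.2 i)) (fun i => hB (x.2 i)) (fun i j => hk _ _)
  rw [fredholmTerm, fredholmBound, norm_mul, norm_div, norm_pow, norm_neg, norm_one, one_pow,
    RCLike.norm_natCast, div_mul_eq_mul_div, div_mul_eq_mul_div, one_mul]
  gcongr

theorem sum_prod_le_tsum_pow {J : Type*} {c : J → ℝ} (hc : ∀ i, 0 ≤ c i) (hs : Summable c) {n : ℕ}
    (t : Finset (Fin n → J)) : ∑ f ∈ t, ∏ i, c (f i) ≤ (∑' i, c i) ^ n := by
  classical
  set F : Finset J := t.biUnion fun f => Finset.univ.image f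
  calc ∑ f ∈ t, ∏ i, c (f i) ≤ ∑ f ∈ Fintype.piFinset fun _ : Fin n => F, ∏ i, c (f i) := by
        refine Finset.sum_le_sum_of_subset_of_nonneg (fun f hf => ?_)
          fun f _ _ => Finset.prod_nonneg fun i _ => hc _
        rw [Fintype.mem_piFinset]
        exact fun i => Finset.mem_biUnion.2 ⟨f, hf, Finset.mem_image_of_mem _ (Finset.mem_univ i)⟩
    _ = (∑ j ∈ F, c j) ^ n := by rw [Finset.sum_prod_piFinset]; simp
    _ ≤ _ := by
        gcongr
        · exact Finset.sum_nonneg fun i _ => hc i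
        · exact hs.sum_le_tsum _ fun i _ => hc i

theorem fredholmBound_nonneg {J : Type*} {c : J → ℝ} (hc : ∀ i, 0 ≤ c i)
    (x : Σ n : ℕ, Fin n → J) : 0 ≤ fredholmBound c x :=
  mul_nonneg (by positivity) (Finset.prod_nonneg fun _ _ => hc _)

theorem summable_fredholmBound {J : Type*} {c : J → ℝ} (hc : ∀ i, 0 ≤ c i) (hs : Summable c) :
    Summable (fredholmBound c) := by
  have hsum : ∀ n : ℕ, Summable fun f : Fin n → J => ∏ i, c (f i) := fun n =>
    summable_of_sum_le (fun f => Finset.prod_nonneg fun i _ => hc _) (sum_prod_le_tsum_pow hc hs)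
  have h1 : ∀ n : ℕ, Summable fun f : Fin n → J => fredholmBound c ⟨n, f⟩ :=
    fun n => (hsum n).mul_left (√n ^ n / n.factorial)
  have h2 : ∀ n : ℕ, ∑' f : Fin n → J, fredholmBound c ⟨n, f⟩ ≤
      √n ^ n * (∑' i, c i) ^ n / n.factorial := by
    intro n
    simp only [fredholmBound]
    rw [tsum_mul_left, ← div_mul_eq_mul_div]
    gcongr
    exact (hsum n).tsum_le_of_sum_le (sum_prod_le_tsum_pow hc hs)
  rw [summable_sigma_of_nonneg (fredholmBound_nonneg hc)]
  exact ⟨h1, Summable.of_nonneg_of_le (fun n => tsum_nonneg fun f => fredholmBound_nonneg hc _)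
    h2 (summable_sqrt_pow_mul_pow_div_factorial (∑' i, c i))⟩

theorem summable_fredholmTerm {J : Type*} {k : J → J → ℂ} {A B : J → ℝ} (hA : ∀ i, 0 ≤ A i)
    (hB : ∀ i, 0 ≤ B i) (hAB : Summable fun i => A i * B i)
    (hk : ∀ i j, ‖k i j‖ ≤ A i * B j) : Summable (fredholmTerm k) :=
  (summable_fredholmBound (fun i => mul_nonneg (hA i) (hB i)) hAB).of_norm_bounded
    (norm_fredholmTerm_le hA hB hk)

/-- The Fredholm series is continuous for dominated entrywise convergence. -/
theorem tendsto_fredholmSum {J θ : Type*} {l : Filter θ} {kl : θ → J → J → ℂ} {k : J → J → ℂ}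
    {A B : J → ℝ} (hA : ∀ i, 0 ≤ A i)
    (hB : ∀ i, 0 ≤ B i) (hAB : Summable fun i => A i * B i)
    (hkl : ∀ t i j, ‖kl t i j‖ ≤ A i * B j)
    (hlim : ∀ i j, Tendsto (fun t => kl t i j) l (𝓝 (k i j))) :
    Tendsto (fun t => fredholmSum (kl t)) l (𝓝 (fredholmSum k)) := by
  refine tendsto_tsum_of_dominated_convergence
    (summable_fredholmBound (fun i => mul_nonneg (hA i) (hB i)) hAB) (fun x => ?_)
    (Eventually.of_forall fun t => norm_fredholmTerm_le hA hB (hkl t))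
  refine Tendsto.const_mul _ ?_
  refine ((continuous_id.matrix_det).tendsto _).comp ?_
  exact tendsto_pi_nhds.2 fun i => tendsto_pi_nhds.2 fun j => hlim _ _

/-- Summing a principal minor over all tuples of indices counts each principal minor `n!` times. -/
theorem sum_det_tuple_eq {m : Type*} [Fintype m] [DecidableEq m] (M : Matrix m m ℂ) (n : ℕ) :
    ∑ f : Fin n → m, (Matrix.of fun i j => M (f i) (f j)).det =
      n.factorial * ∑ s ∈ Finset.univ.powersetCard n,
        (M.submatrix (Subtype.val : s → m) (Subtype.val : s → m)).det := by
  classical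
  have h0 : ∀ f : Fin n → m, ¬ f.Injective → (Matrix.of fun i j => M (f i) (f j)).det = 0 := by
    intro f hf
    simp only [Function.Injective, not_forall] at hf
    obtain ⟨i, j, hij, hne⟩ := hf
    exact Matrix.det_zero_of_row_eq hne (by ext l; simp [hij])
  rw [← Finset.sum_filter_of_ne (p := Function.Injective) (fun f _ hf => by
    by_contra h; exact hf (h0 f h))]
  rw [Finset.mul_sum, ← Finset.sum_fiberwise_of_maps_to (t := Finset.univ.powersetCard n)
    (g := fun f => Finset.univ.image f)]
  · refine Finset.sum_congr rfl fun s hs => ?_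
    have hs' : s.card = n := (Finset.mem_powersetCard.1 hs).2
    -- injective tuples with range `s` correspond to bijections onto `s`
    let F : (Fin n ≃ s) → (Fin n → m) := fun e i => (e i : m)
    have hF : Function.Injective F := fun e e' h => by
      ext i; exact congrFun h i
    have himg : ((Finset.univ.filter (Function.Injective : (Fin n → m) → Prop)).filter
        fun f => Finset.univ.image f = s) = Finset.univ.image F := by
      ext f
      simp only [Finset.mem_filter, Finset.mem_univ, true_and, Finset.mem_image]
      constructor
      · rintro ⟨hf, hfs⟩
        have hmem : ∀ i, f i ∈ s := fun i => hfs ▸ Finset.mem_image_of_mem _ (Finset.mem_univ i)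
        refine ⟨Equiv.ofBijective (fun i => (⟨f i, hmem i⟩ : s)) ⟨fun i j h => hf (by
          simpa using h), ?_⟩, rfl⟩
        rintro ⟨y, hy⟩
        obtain ⟨i, -, hi⟩ := Finset.mem_image.1 (hfs.symm ▸ hy)
        exact ⟨i, Subtype.ext hi⟩
      · rintro ⟨e, rfl⟩
        refine ⟨fun i j h => e.injective (Subtype.ext h), ?_⟩
        ext y
        simp only [Finset.mem_image, Finset.mem_univ, true_and, F]
        constructor
        · rintro ⟨i, rfl⟩; exact (e i).2
        · exact fun hy => ⟨e.symm ⟨y, hy⟩, by simp⟩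
    rw [himg, Finset.sum_image fun e _ e' _ h => hF h]
    have hdet : ∀ e : Fin n ≃ s, (Matrix.of fun i j => M (F e i) (F e j)).det =
        (M.submatrix (Subtype.val : s → m) (Subtype.val : s → m)).det := by
      intro e
      rw [← Matrix.det_submatrix_equiv_self e]
      rfl
    rw [Finset.sum_congr rfl fun e _ => hdet e, Finset.sum_const, Finset.card_univ,
      Fintype.card_equiv ((Fintype.equivFinOfCardEq (by simp [hs'])).symm), nsmul_eq_mul,
      Fintype.card_fin]
  · intro f hf
    rw [Finset.mem_powersetCard]
    refine ⟨Finset.subset_univ _, ?_⟩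
    rw [Finset.card_image_of_injective _ (Finset.mem_filter.1 hf).2, Finset.card_univ,
      Fintype.card_fin]

/-- `det (1 - M)` is the signed sum of all principal minors of `M`. -/
theorem det_one_sub_eq_sum_minors {m : Type*} [Fintype m] [DecidableEq m] (M : Matrix m m ℂ) :
    (1 - M).det = ∑ s : Finset m, (-1) ^ s.card *
      (M.submatrix (Subtype.val : s → m) (Subtype.val : s → m)).det := by
  have h : (1 - M).det =
      Matrix.detRowAlternating ((fun i => -M i) + fun i => (1 : Matrix m m ℂ) i) := by
    change _ = Matrix.det _
    congr 1
    ext i j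
    simp [sub_eq_neg_add]
  rw [h, AlternatingMap.map_add_univ]
  refine Finset.sum_congr rfl fun s _ => ?_
  have h2 : s.piecewise (fun i => -M i) (fun i => (1 : Matrix m m ℂ) i) =
      fun i => (if i ∈ s then (-1 : ℂ) else 1) • s.piecewise M (1 : Matrix m m ℂ) i := by
    funext i
    by_cases hi : i ∈ s <;> simp [hi, Finset.piecewise]
  rw [h2, AlternatingMap.map_smul_univ, Finset.prod_ite_mem, Finset.univ_inter, Finset.prod_const,
    smul_eq_mul, ← Matrix.det_piecewise_one_eq_submatrix_det]
  rfl

/-- **von Koch's formula**: for finite matrices the Fredholm series is `det (1 - M)`. -/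
theorem fredholmSum_eq_det_one_sub {m : Type*} [Fintype m] [DecidableEq m] (M : Matrix m m ℂ) :
    fredholmSum M = (1 - M).det := by
  have hs : Summable (fredholmTerm M) := by
    refine summable_fredholmTerm (A := fun i => ∑ j, ‖M i j‖) (B := fun _ => 1)
      (fun i => by positivity) (fun _ => zero_le_one) ((hasSum_fintype _).summable) fun i j => ?_
    rw [mul_one]
    exact Finset.single_le_sum (f := fun j => ‖M i j‖) (fun _ _ => norm_nonneg _)
      (Finset.mem_univ j)
  unfold fredholmSum
  rw [hs.tsum_sigma, det_one_sub_eq_sum_minors, ← Finset.powerset_univ,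
    Finset.sum_powerset]
  have hn : ∀ n : ℕ, ∑' f : Fin n → m, fredholmTerm M ⟨n, f⟩ =
      ∑ s ∈ Finset.univ.powersetCard n, (-1) ^ s.card *
        (M.submatrix (Subtype.val : s → m) (Subtype.val : s → m)).det := by
    intro n
    rw [tsum_fintype]
    simp only [fredholmTerm]
    rw [← Finset.mul_sum, sum_det_tuple_eq, ← mul_assoc,
      div_mul_cancel₀ _ (Nat.cast_ne_zero.2 n.factorial_ne_zero), Finset.mul_sum]
    exact Finset.sum_congr rfl fun s hs => by rw [(Finset.mem_powersetCard.1 hs).2]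
  simp_rw [hn]
  rw [tsum_eq_sum]
  intro n hn'
  rw [Finset.powersetCard_eq_empty.2 (by simpa [Finset.mem_range] using hn'), Finset.sum_empty]

open Classical in
/-- The matrix `k` with all entries outside `S × S` replaced by `0`. -/
def truncate {J : Type*} (S : Set J) (k : J → J → ℂ) (i j : J) : ℂ :=
  if i ∈ S ∧ j ∈ S then k i j else 0

theorem norm_truncate_le {J : Type*} (S : Set J) (k : J → J → ℂ) (i j : J) :
    ‖truncate S k i j‖ ≤ ‖k i j‖ := by
  rw [truncate]; split_ifs <;> simp

theorem tendsto_truncate {J θ : Type*} {l : Filter θ} {S : θ → Set J} {kl : θ → J → J → ℂ}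
    {k : J → J → ℂ} (hS : ∀ j, ∀ᶠ t in l, j ∈ S t) (i j : J)
    (h : Tendsto (fun t => kl t i j) l (𝓝 (k i j))) :
    Tendsto (fun t => truncate (S t) (kl t) i j) l (𝓝 (k i j)) := by
  refine h.congr' ?_
  filter_upwards [hS i, hS j] with t hi hj
  simp [truncate, hi, hj]

theorem fredholmSum_truncate_range {J m : Type*} [Fintype m] [DecidableEq m] {φ : m → J}
    (hφ : φ.Injective) (k : J → J → ℂ) :
    fredholmSum (truncate (Set.range φ) k) = (1 - Matrix.of fun i j => k (φ i) (φ j)).det := by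
  rw [← fredholmSum_eq_det_one_sub]
  let Φ : (Σ n : ℕ, Fin n → m) → (Σ n : ℕ, Fin n → J) := fun x => ⟨x.1, φ ∘ x.2⟩
  have hΦ : Function.Injective Φ := by
    rintro ⟨n, f⟩ ⟨n', f'⟩ h
    obtain ⟨rfl, h⟩ := Sigma.mk.inj_iff.1 h
    exact Sigma.ext rfl (heq_of_eq (hφ.comp_left (eq_of_heq h)))
  unfold fredholmSum
  rw [← hΦ.tsum_eq]
  · congr 1
    ext x
    simp [fredholmTerm, truncate, Φ]
  · intro x hx
    by_contra hx'
    have : ∃ i, x.2 i ∉ Set.range φ := by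
      by_contra hall
      push Not at hall
      choose g hg using hall
      exact hx' ⟨⟨x.1, g⟩, Sigma.ext rfl (heq_of_eq (funext hg))⟩
    obtain ⟨i, hi⟩ := this
    refine hx ?_
    rw [fredholmTerm, Matrix.det_eq_zero_of_row_eq_zero i fun j => by
      simp only [Matrix.of_apply, truncate]
      rw [if_neg fun h => hi h.1], mul_zero]

/-- Finite sections of `1 - kₜ` converge to the Fredholm series of the limit of `kₜ`, if the
sections exhaust the index set. -/
theorem tendsto_det_section {J θ : Type*} {l : Filter θ} {m : θ → Type*} [∀ t, Fintype (m t)]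
    [∀ t, DecidableEq (m t)] {φ : ∀ t, m t → J} (hφ : ∀ t, (φ t).Injective)
    (hS : ∀ j, ∀ᶠ t in l, j ∈ Set.range (φ t)) {kl : θ → J → J → ℂ}
    {k : J → J → ℂ} {A B : J → ℝ} (hA : ∀ i, 0 ≤ A i) (hB : ∀ i, 0 ≤ B i)
    (hAB : Summable fun i => A i * B i) (hkl : ∀ t i j, ‖kl t i j‖ ≤ A i * B j)
    (hlim : ∀ i j, Tendsto (fun t => kl t i j) l (𝓝 (k i j))) :
    Tendsto (fun t => (1 - Matrix.of fun i j => kl t (φ t i) (φ t j)).det) l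
      (𝓝 (fredholmSum k)) := by
  simp_rw [← fun t => fredholmSum_truncate_range (hφ t) (kl t)]
  exact tendsto_fredholmSum hA hB hAB
    (fun t i j => (norm_truncate_le _ _ _ _).trans (hkl t i j))
    fun i j => tendsto_truncate hS i j (hlim i j)

/-! ### Fredholm determinants of sums of rank-one operators -/

section Hilbert

variable {H : Type} [NormedAddCommGroup H] [InnerProductSpace ℂ H]

theorem norm_sum_inner_mul_inner_le {ι : Type*} {e : ι → H} (he : Orthonormal ℂ e)
    (s : Finset ι) (u v : H) :
    ‖∑ x ∈ s, inner ℂ u (e x) * inner ℂ (e x) v‖ ≤ ‖u‖ * ‖v‖ := by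
  refine (norm_sum_le _ _).trans ?_
  simp only [norm_mul]
  refine (Real.sum_mul_le_sqrt_mul_sqrt s _ _).trans ?_
  refine mul_le_mul ?_ ?_ (Real.sqrt_nonneg _) (norm_nonneg _)
  · refine Real.sqrt_le_iff.2 ⟨norm_nonneg _, ?_⟩
    simp_rw [norm_inner_symm u]
    exact he.sum_inner_products_le u
  · exact Real.sqrt_le_iff.2 ⟨norm_nonneg _, he.sum_inner_products_le v⟩

/-- For `T = ∑ⱼ ⟪uⱼ, ·⟫ vⱼ` of trace class, the finite sections of `det (1 - T)` in any Hilbert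
basis converge to the Fredholm series of the matrix `⟪uᵢ, vⱼ⟫`: for finite sums, this is the
identity `det (1 - VU) = det (1 - UV)`. -/
theorem tendsto_sectionDet {J : Type*} {u v : J → H} (huv : Summable fun j => ‖u j‖ * ‖v j‖)
    {T : H →L[ℂ] H} (hT : ∀ f, HasSum (fun j => inner ℂ (u j) f • v j) (T f)) {ι : Type}
    (e : HilbertBasis ι ℂ H) :
    Tendsto (sectionDet e T) atTop (𝓝 (fredholmSum fun i j => inner ℂ (u i) (v j))) := by
  classical
  have hb : ∀ (s : Finset ι) (i j : J),
      ‖∑ x ∈ s, inner ℂ (u i) (e x) * inner ℂ (e x) (v j)‖ ≤ ‖u i‖ * ‖v j‖ :=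
    fun s i j => norm_sum_inner_mul_inner_le e.orthonormal s _ _
  have h1 : ∀ s : Finset ι, sectionDet e T s =
      fredholmSum fun i j => ∑ x ∈ s, inner ℂ (u i) (e x) * inner ℂ (e x) (v j) := by
    intro s
    let Φ : ∀ F : Finset J, Matrix s F ℂ := fun F => Matrix.of fun x j => inner ℂ (e x) (v j)
    let Ψ : ∀ F : Finset J, Matrix F s ℂ := fun F => Matrix.of fun j y => inner ℂ (u j) (e y)
    have hl : Tendsto (fun F : Finset J => (1 - Φ F * Ψ F).det) atTop (𝓝 (sectionDet e T s)) := by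
      refine ((continuous_id.matrix_det).tendsto _).comp ?_
      refine tendsto_const_nhds.sub ?_
      refine tendsto_pi_nhds.2 fun x => tendsto_pi_nhds.2 fun y => ?_
      have := (hT (e y)).mapL (innerSL ℂ (e x))
      simp only [innerSL_apply_apply, inner_smul_right] at this
      refine this.congr fun F => ?_
      rw [← Finset.sum_coe_sort]
      simp only [Matrix.mul_apply, Φ, Ψ, Matrix.of_apply]
      exact Finset.sum_congr rfl fun j _ => mul_comm _ _
    refine tendsto_nhds_unique hl ?_
    have hr := tendsto_det_section (l := atTop) (m := fun F : Finset J => F)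
      (φ := fun F => Subtype.val)
      (fun F => Subtype.val_injective)
      (fun j => by filter_upwards [eventually_ge_atTop {j}] with F hF; simpa using hF)
      (fun i => norm_nonneg (u i)) (fun j => norm_nonneg (v j)) huv (fun _ => hb s)
      (fun i j => tendsto_const_nhds)
    refine hr.congr fun F => ?_
    rw [Matrix.det_one_sub_mul_comm]
    congr 2
    ext i j
    simp only [Matrix.mul_apply, Φ, Ψ, Matrix.of_apply]
    exact (Finset.sum_coe_sort s fun x => inner ℂ (u i) (e x) * inner ℂ (e x) (v j)).symm
  rw [funext h1]
  exact tendsto_fredholmSum (fun i => norm_nonneg (u i)) (fun j => norm_nonneg (v j)) huv hb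
    fun i j => e.hasSum_inner_mul_inner (u i) (v j)

theorem hasFredholmDet_of_hasSum {J : Type*} (σ : ℕ ≃ J) {u v : J → H}
    (huv : Summable fun j => ‖u j‖ * ‖v j‖) {T : H →L[ℂ] H}
    (hT : ∀ f, HasSum (fun j => inner ℂ (u j) f • v j) (T f)) :
    HasFredholmDet T (fredholmSum fun i j => inner ℂ (u i) (v j)) :=
  ⟨⟨u ∘ σ, v ∘ σ, σ.summable_iff.2 huv, fun f => σ.hasSum_iff.2 (hT f)⟩,
    fun _ e => tendsto_sectionDet huv hT e⟩

/-- An absolutely convergent series of rank-one operators. -/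
theorem exists_hasSum_rankOne [CompleteSpace H] {J : Type*} {u v : J → H}
    (huv : Summable fun j => ‖u j‖ * ‖v j‖) :
    ∃ T : H →L[ℂ] H, ∀ f, HasSum (fun j => inner ℂ (u j) f • v j) (T f) := by
  have hs : Summable fun j => (innerSL ℂ (u j)).smulRight (v j) := by
    refine huv.of_norm_bounded fun j => ?_
    rw [ContinuousLinearMap.norm_smulRight_apply, innerSL_apply_norm]
  refine ⟨∑' j, (innerSL ℂ (u j)).smulRight (v j), fun f => ?_⟩
  have := hs.hasSum.mapL (ContinuousLinearMap.apply ℂ H f)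
  simpa using this

end Hilbert

/-- The determinant of an off-diagonal block matrix: `det (1 - (0 M; N 0)) = det (1 - NM)`. -/
theorem fredholmSum_offDiagonal {I : Type*} {k : I ⊕ I → I ⊕ I → ℂ} {A B : I ⊕ I → ℝ}
    (hA : ∀ i, 0 ≤ A i) (hB : ∀ i, 0 ≤ B i) (hAB : Summable fun i => A i * B i)
    (hk : ∀ i j, ‖k i j‖ ≤ A i * B j) (h₁ : ∀ i j, k (.inl i) (.inl j) = 0)
    (h₂ : ∀ i j, k (.inr i) (.inr j) = 0) :
    fredholmSum k = fredholmSum fun i j => ∑' n, k (.inr i) (.inl n) * k (.inl n) (.inr j) := by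
  classical
  have hABl : Summable fun n => A (.inl n) * B (.inl n) := hAB.comp_injective Sum.inl_injective
  have hABr : Summable fun n => A (.inr n) * B (.inr n) := hAB.comp_injective Sum.inr_injective
  have hterm : ∀ i j n, ‖k (.inr i) (.inl n) * k (.inl n) (.inr j)‖ ≤
      A (.inr i) * B (.inr j) * (A (.inl n) * B (.inl n)) := by
    intro i j n
    rw [norm_mul]
    calc _ ≤ (A (.inr i) * B (.inl n)) * (A (.inl n) * B (.inr j)) :=
          mul_le_mul (hk _ _) (hk _ _) (norm_nonneg _) (mul_nonneg (hA _) (hB _))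
      _ = _ := by ring
  set C := ∑' n, A (.inl n) * B (.inl n)
  have hC : 0 ≤ C := tsum_nonneg fun n => mul_nonneg (hA _) (hB _)
  have h3 := tendsto_det_section (l := atTop) (m := fun F : Finset I => F ⊕ F)
    (φ := fun F => Sum.map Subtype.val Subtype.val)
    (fun F => Subtype.val_injective.sumMap Subtype.val_injective)
    (fun j => by
      rcases j with j | j
      · filter_upwards [eventually_ge_atTop {j}] with F hF
        exact ⟨.inl ⟨j, by simpa using hF⟩, rfl⟩
      · filter_upwards [eventually_ge_atTop {j}] with F hF
        exact ⟨.inr ⟨j, by simpa using hF⟩, rfl⟩)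
    hA hB hAB (fun _ => hk) (fun i j => tendsto_const_nhds)
  refine tendsto_nhds_unique h3 ?_
  have h4 := tendsto_det_section (l := atTop) (m := fun F : Finset I => F)
    (φ := fun F => Subtype.val) (fun F => Subtype.val_injective)
    (fun j => by filter_upwards [eventually_ge_atTop {j}] with F hF; simpa using hF)
    (kl := fun F i j => ∑ n ∈ F, k (.inr i) (.inl n) * k (.inl n) (.inr j))
    (k := fun i j => ∑' n, k (.inr i) (.inl n) * k (.inl n) (.inr j))
    (A := fun i => A (.inr i)) (B := fun i => B (.inr i) * C)
    (fun i => hA _) (fun i => mul_nonneg (hB _) hC)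
    (by simpa only [mul_assoc] using hABr.mul_right C)
    (fun F i j => by
      refine (norm_sum_le_of_le F fun n _ => hterm i j n).trans ?_
      rw [← Finset.mul_sum, ← mul_assoc]
      refine mul_le_mul_of_nonneg_left ?_ (mul_nonneg (hA _) (hB _))
      exact hABl.sum_le_tsum F fun n _ => mul_nonneg (hA _) (hB _))
    (fun i j => ((hABl.mul_left _).of_norm_bounded (hterm i j)).hasSum)
  refine h4.congr fun F => ?_
  have h5 : (1 - Matrix.of fun i j : F ⊕ F =>
      k (Sum.map Subtype.val Subtype.val i) (Sum.map Subtype.val Subtype.val j)) =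
      Matrix.fromBlocks 1 (-Matrix.of fun i j : F => k (.inl i) (.inr j))
        (-Matrix.of fun i j : F => k (.inr i) (.inl j)) 1 := by
    ext (i | i) (j | j) <;> simp [h₁, h₂, Matrix.one_apply]
  rw [h5, Matrix.det_fromBlocks_one₁₁, Matrix.neg_mul, Matrix.mul_neg, neg_neg]
  congr 2
  ext i j
  simp only [Matrix.mul_apply, Matrix.of_apply]
  exact (Finset.sum_coe_sort F fun n => k (.inr i) (.inl n) * k (.inl n) (.inr j)).symm

/-! ### Cyclicity of the Fredholm series -/

theorem det_integral_mul {X Y : Type*} [MeasurableSpace Y] {ν : Measure Y} [SigmaFinite ν]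
    {φ : X → Y → ℂ} {ψ : Y → X → ℂ} {n : ℕ} (x : Fin n → X) :
    (Matrix.of fun i j => ∫ y, φ (x i) y * ψ y (x j) ∂ν).det =
      ∑ σ : Equiv.Perm (Fin n), ((σ.sign : ℤ) : ℂ) *
        ∫ y : Fin n → Y, ∏ i, (φ (x (σ i)) (y i) * ψ (y i) (x i)) ∂(Measure.pi fun _ => ν) := by
  rw [Matrix.det_apply']
  exact Finset.sum_congr rfl fun σ _ => congrArg _
    (integral_fintype_prod_eq_prod fun i y => φ (x (σ i)) y * ψ y (x i)).symm

section Cyclic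

variable {X Y : Type*} [MeasurableSpace X] [MeasurableSpace Y] {μ : Measure X} {ν : Measure Y}
  [SigmaFinite μ] [SigmaFinite ν] {φ : X → Y → ℂ} {ψ : Y → X → ℂ} {A A' : X → ℝ} {C C' : Y → ℝ}

theorem integrable_prod_kernel (hφ : Measurable (Function.uncurry φ))
    (hψ : Measurable (Function.uncurry ψ)) (hφb : ∀ x y, ‖φ x y‖ ≤ A x * C y)
    (hψb : ∀ y x, ‖ψ y x‖ ≤ C' y * A' x) (hA : Integrable (fun x => A x * A' x) μ)
    (hC : Integrable (fun y => C y * C' y) ν) {n : ℕ} (σ : Equiv.Perm (Fin n)) :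
    Integrable (fun p : (Fin n → X) × (Fin n → Y) =>
        ∏ i, (φ (p.1 (σ i)) (p.2 i) * ψ (p.2 i) (p.1 i)))
      ((Measure.pi fun _ => μ).prod (Measure.pi fun _ => ν)) := by
  have h1 : Integrable (fun x : Fin n → X => ∏ i, (A (x i) * A' (x i))) (Measure.pi fun _ => μ) :=
    Integrable.fintype_prod (f := fun _ x => A x * A' x) fun _ => hA
  have h2 : Integrable (fun x : Fin n → Y => ∏ i, (C (x i) * C' (x i))) (Measure.pi fun _ => ν) :=
    Integrable.fintype_prod (f := fun _ x => C x * C' x) fun _ => hC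
  refine (h1.mul_prod h2).mono' ?_ (Eventually.of_forall fun p => ?_)
  · refine (Finset.measurable_prod _ fun i _ => ?_).aestronglyMeasurable
    refine Measurable.mul ?_ ?_
    · exact hφ.comp (f := fun p : (Fin n → X) × (Fin n → Y) => (p.1 (σ i), p.2 i)) (by fun_prop)
    · exact hψ.comp (f := fun p : (Fin n → X) × (Fin n → Y) => (p.2 i, p.1 i)) (by fun_prop)
  · rw [norm_prod]
    calc ∏ i, ‖φ (p.1 (σ i)) (p.2 i) * ψ (p.2 i) (p.1 i)‖
        ≤ ∏ i, (A (p.1 (σ i)) * C (p.2 i) * (C' (p.2 i) * A' (p.1 i))) := by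
          refine Finset.prod_le_prod (fun _ _ => norm_nonneg _) fun i _ => ?_
          rw [norm_mul]
          exact mul_le_mul (hφb _ _) (hψb _ _) (norm_nonneg _) ((norm_nonneg _).trans (hφb _ _))
      _ = _ := by
          simp only [Finset.prod_mul_distrib]
          rw [Equiv.prod_comp σ fun i => A (p.1 i)]
          ring

theorem integrable_det_integral_mul (hφ : Measurable (Function.uncurry φ))
    (hψ : Measurable (Function.uncurry ψ)) (hφb : ∀ x y, ‖φ x y‖ ≤ A x * C y)
    (hψb : ∀ y x, ‖ψ y x‖ ≤ C' y * A' x) (hA : Integrable (fun x => A x * A' x) μ)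
    (hC : Integrable (fun y => C y * C' y) ν) (n : ℕ) :
    Integrable (fun x : Fin n → X => (Matrix.of fun i j => ∫ y, φ (x i) y * ψ y (x j) ∂ν).det)
      (Measure.pi fun _ => μ) := by
  simp_rw [det_integral_mul]
  exact integrable_finsetSum _ fun σ _ =>
    (integrable_prod_kernel hφ hψ hφb hψb hA hC σ).integral_prod_left.const_mul _

/-- The terms of the Fredholm series of `φψ` and `ψφ` agree: expand the determinants over
permutations, exchange the integrals, and permute the variables. -/
theorem integral_det_mul_comm (hφ : Measurable (Function.uncurry φ))
    (hψ : Measurable (Function.uncurry ψ)) (hφb : ∀ x y, ‖φ x y‖ ≤ A x * C y)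
    (hψb : ∀ y x, ‖ψ y x‖ ≤ C' y * A' x) (hA : Integrable (fun x => A x * A' x) μ)
    (hC : Integrable (fun y => C y * C' y) ν) (n : ℕ) :
    ∫ x : Fin n → X, (Matrix.of fun i j => ∫ y, φ (x i) y * ψ y (x j) ∂ν).det
        ∂(Measure.pi fun _ => μ) =
      ∫ y : Fin n → Y, (Matrix.of fun i j => ∫ x, ψ (y i) x * φ x (y j) ∂μ).det
        ∂(Measure.pi fun _ => ν) := by
  have hi := fun σ : Equiv.Perm (Fin n) => integrable_prod_kernel hφ hψ hφb hψb hA hC σ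
  have hi' := fun σ : Equiv.Perm (Fin n) => integrable_prod_kernel (μ := ν) (ν := μ) hψ hφ hψb hφb
    (by simpa only [mul_comm] using hC) (by simpa only [mul_comm] using hA) σ
  simp_rw [det_integral_mul]
  rw [integral_finsetSum _ fun σ _ => (hi σ).integral_prod_left.const_mul _,
    integral_finsetSum _ fun σ _ => (hi' σ).integral_prod_left.const_mul _]
  refine Finset.sum_congr rfl fun σ _ => ?_
  rw [integral_const_mul, integral_const_mul]
  congr 1
  conv_rhs => rw [integral_integral_swap (hi' σ)]
  refine integral_congr_ae (Eventually.of_forall fun x => ?_)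
  have hmp := measurePreserving_piCongrLeft (α := fun _ : Fin n => Y) (fun _ => ν) σ
  conv_rhs => beta_reduce; rw [← hmp.integral_comp']
  refine integral_congr_ae (Eventually.of_forall fun y => ?_)
  simp only [Finset.prod_mul_distrib]
  rw [← Equiv.prod_comp σ fun i => φ (x i) _, mul_comm]
  simp only [MeasurableEquiv.coe_piCongrLeft, Equiv.piCongrLeft_apply_apply]

end Cyclic

theorem pi_count_eq_count (n : ℕ) :
    (Measure.pi fun _ : Fin n => (Measure.count : Measure ℕ)) = Measure.count := by
  rw [Measure.ext_iff_singleton]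
  intro f
  simp [Measure.pi_singleton]

theorem integral_count_eq_tsum {ι : Type*} [Countable ι] [MeasurableSpace ι]
    [MeasurableSingletonClass ι] {f : ι → ℂ} (hf : Summable f) :
    ∫ x, f x ∂Measure.count = ∑' x, f x := by
  rw [integral_countable (integrable_count_iff.2 hf.norm)]
  simp [measureReal_def]

/-- If `K(x, y) = ∑ₗ hₗ(x) gₗ(y)`, then the Fredholm series of the kernel `K` on `L²(μ)` and of the
matrix `⟨gₗ, hₖ⟩` agree. -/
theorem hasSum_fredholm_of_hasSum_mul {X : Type*} [MeasurableSpace X] {μ : Measure X}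
    [SigmaFinite μ] {K : X → X → ℂ} {g h : ℕ → X → ℂ} {A A' : X → ℝ} {a b : ℕ → ℝ}
    (hg : ∀ l, Measurable (g l)) (hh : ∀ l, Measurable (h l))
    (hgb : ∀ l x, ‖g l x‖ ≤ a l * A' x) (hhb : ∀ l x, ‖h l x‖ ≤ A x * b l)
    (hA : Integrable (fun x => A x * A' x) μ) (hA0 : ∀ x, 0 ≤ A x) (hA'0 : ∀ x, 0 ≤ A' x)
    (ha : ∀ l, 0 ≤ a l) (hb : ∀ l, 0 ≤ b l) (hab : Summable fun l => a l * b l)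
    (hK : ∀ x y, HasSum (fun l => h l x * g l y) (K x y)) :
    (∀ n : ℕ, Integrable (fun x : Fin n → X => (Matrix.of fun i j => K (x i) (x j)).det)
      (Measure.pi fun _ => μ)) ∧
    HasSum (fun n : ℕ => (-1 : ℂ) ^ n / (n.factorial : ℂ) *
      ∫ x : Fin n → X, (Matrix.of fun i j => K (x i) (x j)).det ∂(Measure.pi fun _ => μ))
      (fredholmSum fun l k => ∫ x, g l x * h k x ∂μ) := by
  set φ : X → ℕ → ℂ := fun x l => h l x
  have hφ : Measurable (Function.uncurry φ) := measurable_from_prod_countable_left hh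
  have hψ : Measurable (Function.uncurry g) := measurable_from_prod_countable_right hg
  have hC : Integrable (fun l => b l * a l) (Measure.count : Measure ℕ) := by
    simp_rw [mul_comm (b _)]
    exact integrable_count_iff.2 hab.norm
  have hK' : ∀ x y, K x y = ∫ l, φ x l * g l y ∂Measure.count := fun x y => by
    rw [integral_count_eq_tsum (hK x y).summable, (hK x y).tsum_eq]
  simp_rw [hK']
  refine ⟨integrable_det_integral_mul hφ hψ (fun x l => hhb l x) hgb hA hC, ?_⟩
  simp_rw [integral_det_mul_comm hφ hψ (fun x l => hhb l x) hgb hA hC, pi_count_eq_count]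
  set E : ℕ → ℕ → ℂ := fun l k => ∫ x, g l x * h k x ∂μ
  set I := ∫ x, A x * A' x ∂μ
  have hI : 0 ≤ I := integral_nonneg fun x => mul_nonneg (hA0 x) (hA'0 x)
  have hE : ∀ l k, ‖E l k‖ ≤ (a l * I) * b k := by
    intro l k
    calc ‖E l k‖ ≤ ∫ x, a l * b k * (A x * A' x) ∂μ := by
          refine norm_integral_le_of_norm_le (hA.const_mul _) (Eventually.of_forall fun x => ?_)
          rw [norm_mul]
          calc _ ≤ (a l * A' x) * (A x * b k) :=
                mul_le_mul (hgb _ _) (hhb _ _) (norm_nonneg _) (mul_nonneg (ha _) (hA'0 _))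
            _ = _ := by ring
      _ = _ := by rw [integral_const_mul]; ring
  have hs : Summable (fredholmTerm E) :=
    summable_fredholmTerm (fun l => mul_nonneg (ha l) hI) hb
      ((hab.mul_right I).congr fun l => by ring) hE
  have h1 := hs.hasSum.sigma fun n => (hs.sigma_factor n).hasSum
  convert! h1 using 2 with n
  simp only [fredholmTerm]
  rw [tsum_mul_left]
  by_cases hn : (-1 : ℂ) ^ n / (n.factorial : ℂ) = 0
  · simp [hn]
  · rw [integral_count_eq_tsum]
    exact (summable_mul_left_iff hn).1 (hs.sigma_factor n)

/-! ### The gap probability of a determinantal process -/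

/-- The number of `n`-tuples of distinct points of a set with `m` elements is the falling
factorial `m (m - 1) ⋯ (m - n + 1)`. -/
theorem encard_injective_tuples {β : Type*} {S : Set β} (hS : S.Finite) (n : ℕ) :
    {x : Fin n → β | x.Injective ∧ ∀ i, x i ∈ S}.encard =
      ((S.encard.toNat.descFactorial n : ℕ) : ℕ∞) := by
  classical
  have := hS.fintype
  have hrange : {x : Fin n → β | x.Injective ∧ ∀ i, x i ∈ S} =
      Set.range fun (e : Fin n ↪ S) i => (e i : β) := by
    ext x
    simp only [Set.mem_ofPred_eq, Set.mem_range]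
    constructor
    · rintro ⟨hx, hxS⟩
      exact ⟨⟨fun i => ⟨x i, hxS i⟩, fun i j h => hx (by simpa using h)⟩, rfl⟩
    · rintro ⟨e, rfl⟩
      exact ⟨fun i j h => e.injective (Subtype.ext h), fun i => (e i).2⟩
  have hinj : Function.Injective fun (e : Fin n ↪ S) i => (e i : β) := fun e e' h => by
    ext i; exact congrFun h i
  rw [hrange, ← Set.image_univ, hinj.encard_image, Set.encard_univ, ENat.card_eq_coe_fintype_card,
    Fintype.card_embedding_eq, Fintype.card_fin, ← Set.coe_fintypeCard, ENat.toNat_natCast]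

/-- Inclusion-exclusion: `∑ₙ (-1)ⁿ/n! · m (m - 1) ⋯ (m - n + 1)` is `1` if `m = 0` and `0`
otherwise. -/
theorem hasSum_alternating_descFactorial (m : ℕ) :
    HasSum (fun n : ℕ => (-1 : ℝ) ^ n / n.factorial * (m.descFactorial n : ℝ))
      (if m = 0 then 1 else 0) := by
  have h : ∀ n : ℕ, (-1 : ℝ) ^ n / n.factorial * (m.descFactorial n : ℝ) =
      (-1) ^ n * (m.choose n : ℝ) := by
    intro n
    rw [Nat.descFactorial_eq_factorial_mul_choose]
    push_cast
    have : (n.factorial : ℝ) ≠ 0 := Nat.cast_ne_zero.2 n.factorial_ne_zero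
    field_simp
  simp_rw [h]
  have h2 := Int.alternating_sum_range_choose (n := m)
  have h3 : (∑ i ∈ Finset.range (m + 1), (-1 : ℝ) ^ i * (m.choose i : ℝ)) =
      if m = 0 then 1 else 0 := by exact_mod_cast h2
  rw [← h3]
  refine hasSum_sum_of_ne_finset_zero fun n hn => ?_
  rw [Nat.choose_eq_zero_of_lt (by simpa [Nat.lt_succ_iff] using hn)]
  simp

/-- The factorial moments of the number of particles in `(a, ∞)` are the integrals of the
correlation functions, so inclusion-exclusion gives the Fredholm series. The series converges
absolutely because it converges unconditionally. -/
theorem gapProbability_eq_of_hasFredholmSeries {K : ℝ → ℝ → ℂ} {a : ℝ} {d : ℂ}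
    (hK : HasFredholmSeries K a d) {Ω : Type*} [MeasurableSpace Ω] (P : Measure Ω)
    [IsProbabilityMeasure P] (X : Ω → Set ℝ) (hX : IsDeterminantalProcess P X K) :
    (gapProbability P X a : ℂ) = d := by
  choose ρ hρ hρK using hX.correlation
  set B : ∀ n : ℕ, Set (Fin n → ℝ) := fun n => Set.univ.pi fun _ => Set.Ioi a
  have hB : ∀ n, MeasurableSet (B n) := fun n => MeasurableSet.univ_pi fun _ => measurableSet_Ioi
  set N : Ω → ℕ∞ := fun ω => (X ω ∩ Set.Ioi a).encard
  have hN : Measurable N := hX.isPointProcess.measurable_count _ measurableSet_Ioi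
  set M : Ω → ℕ := fun ω => (N ω).toNat
  have hM : Measurable M := (Measurable.of_discrete (f := ENat.toNat)).comp hN
  have hset : ∀ n ω, {x : Fin n → ℝ | x.Injective ∧ (∀ i, x i ∈ X ω) ∧ x ∈ B n} =
      {x : Fin n → ℝ | x.Injective ∧ ∀ i, x i ∈ X ω ∩ Set.Ioi a} := by
    intro n ω
    ext x
    simp only [B, Set.mem_ofPred_eq, Set.mem_univ_pi, Set.mem_inter_iff, forall_and]
  have hρint : ∀ n, IntegrableOn (fun x => (ρ n x : ℝ)) (B n) := by
    intro n
    have := (hK.1 n).congr (ae_restrict_of_ae (by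
      filter_upwards [hρK n] with x hx using hx.symm) :
        _ =ᵐ[volume.restrict (B n)] fun x => ((ρ n x : ℝ) : ℂ))
    exact this.re
  have hρfin : ∀ n, ∫⁻ x in B n, (ρ n x : ℝ≥0∞) ≠ ∞ := by
    intro n
    have := (hρint n).lintegral_lt_top
    simp only [ENNReal.ofReal_coe_nnreal] at this
    exact this.ne
  -- almost surely, there are finitely many particles in `(a, ∞)`
  have hfin : ∀ᵐ ω ∂P, (X ω ∩ Set.Ioi a).Finite := by
    have h1 : ∀ ω, {x : Fin 1 → ℝ | x.Injective ∧ (∀ i, x i ∈ X ω) ∧ x ∈ B 1}.encard = N ω := by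
      intro ω
      rw [hset]
      have : {x : Fin 1 → ℝ | x.Injective ∧ ∀ i, x i ∈ X ω ∩ Set.Ioi a} =
          (fun y (_ : Fin 1) => y) '' (X ω ∩ Set.Ioi a) := by
        ext x
        simp only [Set.mem_ofPred_eq, Set.mem_image, Unique.forall_iff]
        constructor
        · rintro ⟨-, h⟩
          exact ⟨x default, h, by ext i; rw [Subsingleton.elim i default]⟩
        · rintro ⟨y, hy, rfl⟩
          exact ⟨Function.injective_of_subsingleton _, hy⟩
      rw [this, Function.Injective.encard_image]
      exact fun y y' h => congrFun h 0
    have h2 := (hρ 1).2 (B 1) (hB 1)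
    simp_rw [h1] at h2
    have h3 := ae_lt_top ((Measurable.of_discrete (f := fun n : ℕ∞ => (n : ℝ≥0∞))).comp hN)
      (by rw [Function.comp_def, h2]; exact hρfin 1)
    filter_upwards [h3] with ω hω
    rw [← Set.encard_lt_top_iff]
    exact ENat.toENNReal_lt_top.1 hω
  have hmom : ∀ n, ∫⁻ ω, ((M ω).descFactorial n : ℝ≥0∞) ∂P = ∫⁻ x in B n, (ρ n x : ℝ≥0∞) := by
    intro n
    rw [← (hρ n).2 (B n) (hB n)]
    refine lintegral_congr_ae ?_
    filter_upwards [hfin] with ω hω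
    rw [hset, encard_injective_tuples hω]
    simp [M, N]
  have hMn : ∀ n, Measurable fun ω => ((M ω).descFactorial n : ℝ) := fun n =>
    (Measurable.of_discrete (f := fun m : ℕ => (m.descFactorial n : ℝ))).comp hM
  have hMint : ∀ n, Integrable (fun ω => ((M ω).descFactorial n : ℝ)) P := by
    intro n
    refine ⟨(hMn n).aestronglyMeasurable, ?_⟩
    rw [hasFiniteIntegral_iff_ofReal (Eventually.of_forall fun ω => by positivity)]
    simp only [ENNReal.ofReal_natCast, hmom]
    exact (hρfin n).lt_top
  have hMval : ∀ n, ∫ ω, ((M ω).descFactorial n : ℝ) ∂P = ∫ x in B n, (ρ n x : ℝ) := by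
    intro n
    rw [integral_eq_lintegral_of_nonneg_ae (Eventually.of_forall fun ω => by positivity)
      (hMn n).aestronglyMeasurable, integral_eq_lintegral_of_nonneg_ae
      (Eventually.of_forall fun x => by positivity) (hρint n).aestronglyMeasurable]
    simp only [ENNReal.ofReal_coe_nnreal, ENNReal.ofReal_natCast, hmom]
  have hterm : ∀ n : ℕ, (-1 : ℂ) ^ n / (n.factorial : ℂ) *
      ∫ x in B n, (Matrix.of fun j k => K (x j) (x k)).det =
      ((∫ ω, (-1 : ℝ) ^ n / n.factorial * ((M ω).descFactorial n : ℝ) ∂P : ℝ) : ℂ) := by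
    intro n
    rw [integral_const_mul, hMval]
    push_cast
    rw [← integral_complex_ofReal]
    congr 1
    exact integral_congr_ae (ae_restrict_of_ae (by
      filter_upwards [hρK n] with x hx using hx.symm))
  have hs : HasSum (fun n : ℕ =>
      ((∫ ω, (-1 : ℝ) ^ n / n.factorial * ((M ω).descFactorial n : ℝ) ∂P : ℝ) : ℂ)) d := by
    convert! hK.2 using 2 with n
    exact (hterm n).symm
  have hnorm : ∀ n : ℕ, ∫ ω, ‖(-1 : ℝ) ^ n / n.factorial * ((M ω).descFactorial n : ℝ)‖ ∂P =
      ‖((∫ ω, (-1 : ℝ) ^ n / n.factorial * ((M ω).descFactorial n : ℝ) ∂P : ℝ) : ℂ)‖ := by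
    intro n
    simp only [norm_mul, Complex.norm_real, integral_const_mul, RCLike.norm_natCast]
    congr 1
    rw [Real.norm_of_nonneg (integral_nonneg fun ω => by positivity)]
  have h1 := hasSum_integral_of_summable_integral_norm
    (F := fun (n : ℕ) ω => (-1 : ℝ) ^ n / n.factorial * ((M ω).descFactorial n : ℝ))
    (fun n => (hMint n).const_mul _) (by simpa only [hnorm] using hs.summable.norm)
  have h2 : ∫ ω, ∑' n : ℕ, (-1 : ℝ) ^ n / n.factorial * ((M ω).descFactorial n : ℝ) ∂P =
      gapProbability P X a := by
    rw [integral_congr_ae (Eventually.of_forall fun ω =>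
      (hasSum_alternating_descFactorial (M ω)).tsum_eq)]
    have h3 : ∀ ω, (if M ω = 0 then (1 : ℝ) else 0) = (M ⁻¹' {0}).indicator 1 ω := by
      intro ω
      by_cases h : M ω = 0 <;> simp [h]
    rw [integral_congr_ae (Eventually.of_forall h3),
      integral_indicator_one (hM (measurableSet_singleton 0)), gapProbability]
    refine measureReal_congr ?_
    filter_upwards [hfin] with ω hω
    refine propext ?_
    change M ω = 0 ↔ X ω ∩ Set.Ioi a = ∅
    simp only [M, N]
    rw [ENat.toNat_eq_zero, Set.encard_eq_zero]
    simp [hω]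
  rw [h2] at h1
  exact (Complex.hasSum_ofReal.2 h1).unique hs

/-! ### Expansion of the Cauchy kernel -/

/-- The functions `(p - 1)ⁿ / (p + 1)ⁿ⁺¹` on the right half-plane, which are the Laplace transforms
of Laguerre functions; they separate the variables of the Cauchy kernel `1 / (p + q)`. -/
def cayley (n : ℕ) (p : ℂ) : ℂ := (p - 1) ^ n / (p + 1) ^ (n + 1)

@[fun_prop]
theorem measurable_cayley (n : ℕ) : Measurable (cayley n) := by
  unfold cayley
  fun_prop

theorem add_one_ne_zero_of_re_pos {p : ℂ} (hp : 0 < p.re) : p + 1 ≠ 0 := fun h => by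
  have := congrArg Complex.re h
  simp at this
  linarith

theorem norm_cayley_ratio_lt_one {p : ℂ} (hp : 0 < p.re) : ‖(p - 1) / (p + 1)‖ < 1 := by
  rw [norm_div, div_lt_one (norm_pos_iff.2 (add_one_ne_zero_of_re_pos hp))]
  refine lt_of_pow_lt_pow_left₀ 2 (norm_nonneg _) ?_
  rw [Complex.sq_norm, Complex.sq_norm, Complex.normSq_apply, Complex.normSq_apply]
  simp
  nlinarith

theorem hasSum_cayley_mul_cayley {p q : ℂ} (hp : 0 < p.re) (hq : 0 < q.re) :
    HasSum (fun n => cayley n p * cayley n q) (1 / (2 * (p + q))) := by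
  have hp1 := add_one_ne_zero_of_re_pos hp
  have hq1 := add_one_ne_zero_of_re_pos hq
  have hpq : p + q ≠ 0 := fun h => by
    have := congrArg Complex.re h
    simp at this
    linarith
  set w := (p - 1) / (p + 1) * ((q - 1) / (q + 1))
  have hw : ‖w‖ < 1 := by
    rw [norm_mul]
    exact mul_lt_one_of_nonneg_of_lt_one_left (norm_nonneg _) (norm_cayley_ratio_lt_one hp)
      (norm_cayley_ratio_lt_one hq).le
  have h := (hasSum_geometric_of_norm_lt_one hw).mul_left (1 / ((p + 1) * (q + 1)))
  have h1 : 1 - w = 2 * (p + q) / ((p + 1) * (q + 1)) := by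
    simp only [w]
    field_simp
    ring
  convert! h using 1
  · ext n
    simp only [cayley, w, mul_pow, div_pow, pow_succ]
    field_simp
  · rw [h1]
    field_simp

theorem cayley_conj (n : ℕ) (p : ℂ) :
    cayley n (starRingEnd ℂ p) = starRingEnd ℂ (cayley n p) := by simp [cayley]

theorem hasSum_sq_norm_cayley {p : ℂ} (hp : 0 < p.re) :
    HasSum (fun n => ‖cayley n p‖ ^ 2) (1 / (4 * p.re)) := by
  have h := hasSum_cayley_mul_cayley hp (q := starRingEnd ℂ p) (by simpa using hp)
  rw [← Complex.hasSum_ofReal]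
  convert! h using 1
  · ext n
    rw [cayley_conj, Complex.mul_conj, Complex.normSq_eq_norm_sq]
  · rw [Complex.add_conj]
    push_cast
    ring

theorem norm_cayley_le {ε : ℝ} (hε : 0 < ε) {p : ℂ} (hp : ε ≤ p.re) (n : ℕ) :
    ‖cayley n p‖ ^ 2 ≤ 1 / (4 * ε) :=
  ((hasSum_sq_norm_cayley (hε.trans_le hp)).summable.le_tsum n fun _ _ => by positivity).trans (by
    rw [(hasSum_sq_norm_cayley (hε.trans_le hp)).tsum_eq]
    gcongr)

theorem norm_cayley_le_sqrt {ε : ℝ} (hε : 0 < ε) {p : ℂ} (hp : ε ≤ p.re) (n : ℕ) :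
    ‖cayley n p‖ ≤ √(1 / (4 * ε)) :=
  Real.le_sqrt_of_sq_le (norm_cayley_le hε hp n)

theorem summable_norm_cayley {p : ℂ} (hp : 0 < p.re) : Summable fun n => ‖cayley n p‖ := by
  refine ((summable_geometric_of_lt_one (norm_nonneg _) (norm_cayley_ratio_lt_one hp)).mul_right
    ‖(p + 1)⁻¹‖).congr fun n => ?_
  rw [← norm_pow, ← norm_mul]
  congr 1
  have := add_one_ne_zero_of_re_pos hp
  rw [cayley, div_pow, pow_succ]
  field_simp

section Weighted

variable {μ : Measure ℂ} {κ : ℂ → ℂ} {ε : ℝ}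

theorem aestronglyMeasurable_cayley_comp (hκ : Measurable κ) (n : ℕ) :
    AEStronglyMeasurable (fun z => cayley n (κ z)) μ :=
  ((measurable_cayley n).comp hκ).aestronglyMeasurable

theorem integrable_mul_cayley (hκ : Measurable κ) (hε : 0 < ε) {F : ℂ → ℂ} (hF : Integrable F μ)
    (hFκ : ∀ z, F z ≠ 0 → ε ≤ (κ z).re) (n : ℕ) : Integrable (fun z => F z * cayley n (κ z)) μ := by
  refine (hF.norm.mul_const √(1 / (4 * ε))).mono'
    (hF.aestronglyMeasurable.mul (aestronglyMeasurable_cayley_comp hκ n))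
    (Eventually.of_forall fun z => ?_)
  rw [norm_mul]
  by_cases h : F z = 0
  · simp [h]
  · gcongr
    exact norm_cayley_le_sqrt hε (hFκ z h) n

theorem memLp_mul_cayley (hκ : Measurable κ) (hε : 0 < ε) {F : ℂ → ℂ} (hF : MemLp F 2 μ)
    (hFκ : ∀ z, F z ≠ 0 → ε ≤ (κ z).re) (n : ℕ) : MemLp (fun z => F z * cayley n (κ z)) 2 μ := by
  refine hF.of_le_mul (c := √(1 / (4 * ε)))
    (hF.aestronglyMeasurable.mul (aestronglyMeasurable_cayley_comp hκ n))
    (Eventually.of_forall fun z => ?_)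
  rw [norm_mul, mul_comm]
  by_cases h : F z = 0
  · simp [h]
  · gcongr
    exact norm_cayley_le_sqrt hε (hFκ z h) n

/-- Integrating the bound `∑ₙ |cayley n p|² = 1 / (4 Re p)` against a weight. -/
theorem summable_integral_mul_sq_norm_cayley (hκ : Measurable κ) (hε : 0 < ε) {w : ℂ → ℝ}
    (hw : Integrable w μ) (hw0 : ∀ z, 0 ≤ w z) (hwκ : ∀ z, w z ≠ 0 → ε ≤ (κ z).re) :
    (∀ n, Integrable (fun z => w z * ‖cayley n (κ z)‖ ^ 2) μ) ∧
      Summable fun n => ∫ z, w z * ‖cayley n (κ z)‖ ^ 2 ∂μ := by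
  have hi : ∀ n, Integrable (fun z => w z * ‖cayley n (κ z)‖ ^ 2) μ := by
    intro n
    refine (hw.mul_const (1 / (4 * ε))).mono'
      (hw.aestronglyMeasurable.mul ((aestronglyMeasurable_cayley_comp hκ n).norm.pow 2))
      (Eventually.of_forall fun z => ?_)
    rw [Real.norm_of_nonneg (mul_nonneg (hw0 z) (by positivity))]
    by_cases h : w z = 0
    · simp [h]
    · exact mul_le_mul_of_nonneg_left (norm_cayley_le hε (hwκ z h) n) (hw0 z)
  refine ⟨hi, summable_of_sum_le (c := ∫ z, w z * (1 / (4 * ε)) ∂μ)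
    (fun n => integral_nonneg fun z => mul_nonneg (hw0 z) (by positivity)) fun t => ?_⟩
  rw [← integral_finsetSum _ fun n _ => hi n]
  refine integral_mono (integrable_finsetSum _ fun n _ => hi n) (hw.mul_const _) fun z => ?_
  simp only
  rw [← Finset.mul_sum]
  by_cases h : w z = 0
  · simp [h]
  · have hpos := hε.trans_le (hwκ z h)
    refine mul_le_mul_of_nonneg_left ?_ (hw0 z)
    refine ((hasSum_sq_norm_cayley hpos).summable.sum_le_tsum t fun _ _ => by positivity).trans ?_
    rw [(hasSum_sq_norm_cayley hpos).tsum_eq]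
    have := hwκ z h
    gcongr

theorem summable_sq_norm_toLp_mul_cayley (hκ : Measurable κ) (hε : 0 < ε) {F : ℂ → ℂ}
    (hF : MemLp F 2 μ) (hFκ : ∀ z, F z ≠ 0 → ε ≤ (κ z).re) {u : ℕ → Lp ℂ 2 μ}
    (hu : ∀ n, ∀ᵐ z ∂μ, ‖u n z‖ = ‖F z * cayley n (κ z)‖) : Summable fun n => ‖u n‖ ^ 2 := by
  refine (summable_integral_mul_sq_norm_cayley hκ hε (w := fun z => ‖F z‖ ^ 2)
    ((memLp_two_iff_integrable_sq_norm hF.aestronglyMeasurable).1 hF) (fun z => by positivity)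
    (fun z hz => hFκ z (by simpa using hz))).2.congr fun n => ?_
  rw [← inner_self_eq_norm_sq (𝕜 := ℂ), L2.inner_def, ← integral_re]
  · refine integral_congr_ae ?_
    filter_upwards [hu n] with z hz
    rw [inner_self_eq_norm_sq, hz, norm_mul, mul_pow]
  · exact L2.integrable_inner _ _

/-- Cauchy-Schwarz: the coefficients of an integrable function are square summable. -/
theorem summable_sq_integral_mul_norm_cayley (hκ : Measurable κ) (hε : 0 < ε) {F : ℂ → ℂ}
    (hF : Integrable F μ) (hFκ : ∀ z, F z ≠ 0 → ε ≤ (κ z).re) :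
    Summable fun n => (∫ z, ‖F z * cayley n (κ z)‖ ∂μ) ^ 2 := by
  obtain ⟨hi, hs⟩ := summable_integral_mul_sq_norm_cayley hκ hε hF.norm (fun z => norm_nonneg _)
    (fun z hz => hFκ z (by simpa using hz))
  refine Summable.of_nonneg_of_le (fun n => by positivity) (fun n => ?_)
    (hs.mul_left (∫ z, ‖F z‖ ∂μ))
  have hsqrt : MemLp (fun z => √‖F z‖) (ENNReal.ofReal 2) μ := by
    rw [ENNReal.ofReal_ofNat, memLp_two_iff_integrable_sq_norm
      (Real.continuous_sqrt.comp_aestronglyMeasurable hF.norm.aestronglyMeasurable)]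
    simpa [Real.sq_sqrt] using hF.norm
  have hsqrt' : MemLp (fun z => √‖F z‖ * ‖cayley n (κ z)‖) (ENNReal.ofReal 2) μ := by
    have hm : AEStronglyMeasurable (fun z => √‖F z‖ * ‖cayley n (κ z)‖) μ :=
      (Real.continuous_sqrt.comp_aestronglyMeasurable hF.norm.aestronglyMeasurable).mul
        (aestronglyMeasurable_cayley_comp hκ n).norm
    rw [ENNReal.ofReal_ofNat, memLp_two_iff_integrable_sq_norm hm]
    simpa [mul_pow, Real.sq_sqrt] using hi n
  have h := integral_mul_le_Lp_mul_Lq_of_nonneg Real.HolderConjugate.two_two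
    (Eventually.of_forall fun z => Real.sqrt_nonneg _)
    (Eventually.of_forall fun z => by positivity) hsqrt hsqrt'
  simp only [Real.rpow_two, mul_pow, Real.sq_sqrt (norm_nonneg _), ← mul_assoc,
    Real.mul_self_sqrt (norm_nonneg _), ← Real.sqrt_eq_rpow] at h
  simp only [norm_mul]
  calc _ ≤ (√(∫ z, ‖F z‖ ∂μ) * √(∫ z, ‖F z‖ * ‖cayley n (κ z)‖ ^ 2 ∂μ)) ^ 2 := by
        gcongr
    _ = _ := by
        rw [mul_pow, Real.sq_sqrt (integral_nonneg fun _ => norm_nonneg _),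
          Real.sq_sqrt (integral_nonneg fun _ => by positivity)]

/-- The Cauchy transform of `F` expanded in the functions `cayley n`. -/
theorem hasSum_cayley_mul_integral (hκ : Measurable κ) (hε : 0 < ε) {F : ℂ → ℂ}
    (hF : Integrable F μ) (hFκ : ∀ z, F z ≠ 0 → ε ≤ (κ z).re) {q : ℂ} (hq : 0 < q.re) :
    HasSum (fun n => cayley n q * ∫ z, F z * cayley n (κ z) ∂μ)
      (∫ z, F z / (2 * (q + κ z)) ∂μ) := by
  have h := hasSum_integral_of_summable_integral_norm
    (F := fun n z => cayley n q * (F z * cayley n (κ z)))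
    (fun n => (integrable_mul_cayley hκ hε hF hFκ n).const_mul _) (by
      refine Summable.of_nonneg_of_le (fun n => integral_nonneg fun _ => norm_nonneg _)
        (fun n => ?_)
        ((summable_norm_cayley hq).mul_right (∫ z, ‖F z‖ * √(1 / (4 * ε)) ∂μ))
      simp only [norm_mul, integral_const_mul]
      refine mul_le_mul_of_nonneg_left (integral_mono ?_ (hF.norm.mul_const _) fun z => ?_)
        (norm_nonneg _)
      · simpa only [norm_mul] using (integrable_mul_cayley hκ hε hF hFκ n).norm
      · by_cases hz : F z = 0
        · simp [hz]
        · exact mul_le_mul_of_nonneg_left (norm_cayley_le_sqrt hε (hFκ z hz) n) (norm_nonneg _))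
  simp only [integral_const_mul] at h
  convert! h using 1
  refine integral_congr_ae (Eventually.of_forall fun z => ?_)
  simp only
  by_cases hz : F z = 0
  · simp [hz]
  · rw [div_eq_mul_one_div,
      ← ((hasSum_cayley_mul_cayley hq (hε.trans_le (hFκ z hz))).mul_left (F z)).tsum_eq]
    exact tsum_congr fun n => by ring

end Weighted

/-! ### Operators with Cauchy kernels between two half-planes -/

/-- An unconditionally convergent series in `L²` converges to its sum almost everywhere, wherever
it converges pointwise. -/
theorem ae_eq_of_hasSum_L2 {α J : Type*} [MeasurableSpace α] {μ : Measure α} (σ : ℕ ≃ J)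
    {g : J → Lp ℂ 2 μ} {T : Lp ℂ 2 μ} (hT : HasSum g T) {φ : J → α → ℂ}
    (hg : ∀ j, g j =ᵐ[μ] φ j) : ∀ᵐ x ∂μ, ∀ s, HasSum (fun j => φ j x) s → T x = s := by
  have h1 := (σ.hasSum_iff.2 hT).tendsto_sum_nat
  obtain ⟨ns, hns, hae⟩ := (tendstoInMeasure_of_tendsto_Lp h1).exists_seq_tendsto_ae
  have h2 : ∀ᵐ x ∂μ, ∀ N : ℕ, (∑ i ∈ Finset.range N, (g ∘ σ) i : Lp ℂ 2 μ) x =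
      ∑ i ∈ Finset.range N, (g (σ i) : α → ℂ) x := by
    refine ae_all_iff.2 fun N => ?_
    filter_upwards [Lp.coeFn_finsetSum (Finset.range N) (g ∘ σ)] with x hx
    simpa using hx
  filter_upwards [hae, h2, ae_all_iff.2 fun i => hg (σ i)] with x hx hx2 hx3 s hs
  refine tendsto_nhds_unique hx ?_
  have h3 := ((σ.hasSum_iff.2 hs).tendsto_sum_nat).comp hns.tendsto_atTop
  exact h3.congr fun i => ((hx2 (ns i)).trans (Finset.sum_congr rfl fun j _ => hx3 j)).symm

section TwoContours

variable {μ : Measure ℂ} {δ b : ℝ}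

/-- The Cauchy kernel in separated variables. -/
theorem hasSum_integral_mul_integral (hδb : δ < b) {F G : ℂ → ℂ} (hF : Integrable F μ)
    (hG : Integrable G μ) (hFb : ∀ z, F z ≠ 0 → b ≤ z.re) (hGδ : ∀ z, G z ≠ 0 → z.re ≤ δ) :
    HasSum (fun n => (∫ t, G t * cayley n (((δ + b) / 2 : ℝ) - t) ∂μ) *
        ∫ s, F s * cayley n (s - ((δ + b) / 2 : ℝ)) ∂μ)
      (∫ s, F s * ∫ t, G t / (2 * (s - t)) ∂μ ∂μ) := by
  set c : ℝ := (δ + b) / 2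
  set ε : ℝ := (b - δ) / 2
  have hε : 0 < ε := by simp only [ε]; linarith
  have hκ₁ : Measurable fun z : ℂ => (c : ℂ) - z := by fun_prop
  have hκ₂ : Measurable fun z : ℂ => z - (c : ℂ) := by fun_prop
  have hF' : ∀ z, F z ≠ 0 → ε ≤ (z - (c : ℂ)).re := fun z hz => by
    have := hFb z hz
    simp [c, ε]; linarith
  have hG' : ∀ z, G z ≠ 0 → ε ≤ ((c : ℂ) - z).re := fun z hz => by
    have := hGδ z hz
    simp [c, ε]; linarith
  have h := hasSum_integral_of_summable_integral_norm
    (F := fun n s => (∫ t, G t * cayley n (c - t) ∂μ) * (F s * cayley n (s - c)))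
    (fun n => (integrable_mul_cayley hκ₂ hε hF hF' n).const_mul _) (by
      refine Summable.of_nonneg_of_le (fun n => integral_nonneg fun _ => norm_nonneg _)
        (fun n => ?_) ((summable_sq_integral_mul_norm_cayley hκ₁ hε hG hG').add
          (summable_sq_integral_mul_norm_cayley hκ₂ hε hF hF'))
      simp only [norm_mul (∫ t, _ ∂μ), integral_const_mul]
      have h1 : ‖∫ t, G t * cayley n (c - t) ∂μ‖ ≤ _ := norm_integral_le_integral_norm _
      have h2 : 0 ≤ ∫ s, ‖F s * cayley n (s - c)‖ ∂μ := integral_nonneg fun _ => norm_nonneg _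
      have h3 := mul_le_mul_of_nonneg_right h1 h2
      nlinarith [sq_nonneg ((∫ t, ‖G t * cayley n (c - t)‖ ∂μ) -
        ∫ s, ‖F s * cayley n (s - c)‖ ∂μ), sq_nonneg (∫ t, ‖G t * cayley n (c - t)‖ ∂μ),
        sq_nonneg (∫ s, ‖F s * cayley n (s - c)‖ ∂μ)])
  simp only [integral_const_mul] at h
  convert! h using 1
  refine integral_congr_ae (Eventually.of_forall fun s => ?_)
  simp only
  by_cases hs : F s = 0
  · simp [hs]
  · have h4 := hasSum_cayley_mul_integral hκ₁ hε hG hG' (hε.trans_le (hF' s hs))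
    simp only [sub_add_sub_cancel] at h4
    rw [← (h4.mul_left (F s)).tsum_eq]
    exact tsum_congr fun n => by ring

/-- The Cauchy kernel as a Laplace integral: `1 / (s - t) = ∫ₐ^∞ exp (-(x - a) (s - t)) dx`. -/
theorem integral_laplace_mul_laplace [SFinite μ] (hδb : δ < b) (a : ℝ) {F G : ℂ → ℂ}
    (hF : Integrable F μ) (hG : Integrable G μ) (hFb : ∀ z, F z ≠ 0 → b ≤ z.re)
    (hGδ : ∀ z, G z ≠ 0 → z.re ≤ δ) :
    ∫ x in Set.Ioi a, (∫ s, F s * Complex.exp (-((x - a : ℝ) : ℂ) * s) ∂μ) *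
        ∫ t, G t * Complex.exp (((x - a : ℝ) : ℂ) * t) ∂μ =
      ∫ s, F s * ∫ t, G t / (s - t) ∂μ ∂μ := by
  have hFG := hF.mul_prod hG
  set H : ℝ → ℂ × ℂ → ℂ := fun x p =>
    F p.1 * G p.2 * Complex.exp (-((x - a : ℝ) : ℂ) * (p.1 - p.2))
  have hb : 0 < b - δ := by linarith
  have hexp : IntegrableOn (fun x => Real.exp (-(b - δ) * (x - a))) (Set.Ioi a) := by
    have := (exp_neg_integrableOn_Ioi a hb).mul_const (Real.exp ((b - δ) * a))
    refine this.congr (Eventually.of_forall fun x => ?_)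
    simp only
    rw [← Real.exp_add]
    congr 1
    ring
  have hH : Integrable (Function.uncurry H) ((volume.restrict (Set.Ioi a)).prod (μ.prod μ)) := by
    refine (Integrable.mul_prod hexp hFG.norm).mono' ?_ ?_
    · refine AEStronglyMeasurable.mul ?_ ?_
      · exact hFG.aestronglyMeasurable.comp_snd
      · exact (by fun_prop : Continuous fun q : ℝ × ℂ × ℂ =>
          Complex.exp (-((q.1 - a : ℝ) : ℂ) * (q.2.1 - q.2.2))).aestronglyMeasurable
    · have hmem : ∀ᵐ q ∂((volume.restrict (Set.Ioi a)).prod (μ.prod μ)), a < q.1 := by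
        refine Measure.quasiMeasurePreserving_fst.ae ?_
        exact ae_restrict_mem measurableSet_Ioi
      filter_upwards [hmem] with q hq
      simp only [Function.uncurry, H]
      rw [norm_mul, mul_comm]
      by_cases h0 : F q.2.1 * G q.2.2 = 0
      · simp [h0]
      · refine mul_le_mul_of_nonneg_right ?_ (norm_nonneg _)
        rw [Complex.norm_exp, Real.exp_le_exp]
        have h1 := hFb _ (left_ne_zero_of_mul h0)
        have h2 := hGδ _ (right_ne_zero_of_mul h0)
        have h3 : (-((q.1 - a : ℝ) : ℂ) * (q.2.1 - q.2.2)).re =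
            -(q.1 - a) * (q.2.1.re - q.2.2.re) := by
          rw [← Complex.ofReal_neg, Complex.re_ofReal_mul, Complex.sub_re]
        rw [h3]
        nlinarith
  have hin : ∀ p : ℂ × ℂ, ∫ x in Set.Ioi a, H x p = F p.1 * (G p.2 / (p.1 - p.2)) := by
    intro p
    simp only [H]
    rw [integral_const_mul]
    by_cases h0 : F p.1 * G p.2 = 0
    · rcases mul_eq_zero.1 h0 with h | h <;> simp [h]
    · have h1 := hFb _ (left_ne_zero_of_mul h0)
      have h2 := hGδ _ (right_ne_zero_of_mul h0)
      have h3 : p.1 - p.2 ≠ 0 := fun h => by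
        have := congrArg Complex.re h
        simp at this
        linarith
      have h4 := integral_exp_mul_complex_Ioi (a := -(p.1 - p.2)) (by simp; linarith) a
      have h5 : ∀ x : ℝ, Complex.exp (-((x - a : ℝ) : ℂ) * (p.1 - p.2)) =
          Complex.exp (a * (p.1 - p.2)) * Complex.exp (-(p.1 - p.2) * x) := by
        intro x
        rw [← Complex.exp_add]
        congr 1
        push_cast
        ring
      simp_rw [h5]
      rw [integral_const_mul, h4, ← mul_div_assoc, mul_neg, ← Complex.exp_add]
      have h6 : (a : ℂ) * (p.1 - p.2) + -(p.1 - p.2) * a = 0 := by ring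
      rw [h6, Complex.exp_zero, neg_div_neg_eq]
      ring
  calc _ = ∫ x in Set.Ioi a, ∫ p, H x p ∂(μ.prod μ) := by
        refine integral_congr_ae (Eventually.of_forall fun x => ?_)
        simp only [H]
        rw [← integral_prod_mul]
        refine integral_congr_ae (Eventually.of_forall fun p => ?_)
        simp only
        rw [show -((x - a : ℝ) : ℂ) * (p.1 - p.2) =
          -((x - a : ℝ) : ℂ) * p.1 + ((x - a : ℝ) : ℂ) * p.2 by ring, Complex.exp_add]
        ring
    _ = ∫ p, (∫ x in Set.Ioi a, H x p) ∂(μ.prod μ) := integral_integral_swap hH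
    _ = ∫ p, F p.1 * (G p.2 / (p.1 - p.2)) ∂(μ.prod μ) := by simp_rw [hin]
    _ = _ := by
        rw [integral_prod]
        · simp_rw [integral_const_mul]
        · exact hH.integral_prod_right.congr (Eventually.of_forall hin)

end TwoContours

theorem inner_toLp_eq_integral {μ : Measure ℂ} {u : ℂ → ℂ} (hu : MemLp u 2 μ)
    (g : Lp ℂ 2 μ) : inner ℂ (hu.toLp u) g = ∫ z, starRingEnd ℂ (u z) * g z ∂μ := by
  rw [L2.inner_def]
  refine integral_congr_ae ?_
  filter_upwards [hu.coeFn_toLp] with z hz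
  rw [hz, RCLike.inner_apply, mul_comm]

section Families

variable {μ : Measure ℂ} {κ : ℂ → ℂ} {ε : ℝ} {f : ℂ → ℂ}

/-- The vectors `f · cayley n ∘ κ` of `L²(μ)`, for a weight `f` in `L²(μ)`. -/
def cayleyVec (hκ : Measurable κ) (hε : 0 < ε) (hf : MemLp f 2 μ)
    (hfκ : ∀ z, f z ≠ 0 → ε ≤ (κ z).re) (n : ℕ) : Lp ℂ 2 μ :=
  (memLp_mul_cayley hκ hε hf hfκ n).toLp _

theorem coeFn_cayleyVec (hκ : Measurable κ) (hε : 0 < ε) (hf : MemLp f 2 μ)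
    (hfκ : ∀ z, f z ≠ 0 → ε ≤ (κ z).re) (n : ℕ) :
    cayleyVec hκ hε hf hfκ n =ᵐ[μ] fun z => f z * cayley n (κ z) :=
  MemLp.coeFn_toLp _

theorem summable_sq_norm_cayleyVec (hκ : Measurable κ) (hε : 0 < ε) (hf : MemLp f 2 μ)
    (hfκ : ∀ z, f z ≠ 0 → ε ≤ (κ z).re) : Summable fun n => ‖cayleyVec hκ hε hf hfκ n‖ ^ 2 :=
  summable_sq_norm_toLp_mul_cayley hκ hε hf hfκ fun n => by
    filter_upwards [coeFn_cayleyVec hκ hε hf hfκ n] with z hz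
    rw [hz]

theorem summable_norm_mul_norm_of_sq {E : Type*} [SeminormedAddCommGroup E] {u v : ℕ → E}
    (hu : Summable fun n => ‖u n‖ ^ 2) (hv : Summable fun n => ‖v n‖ ^ 2) :
    Summable fun n => ‖u n‖ * ‖v n‖ :=
  Summable.of_nonneg_of_le (fun n => by positivity)
    (fun n => by nlinarith [sq_nonneg (‖u n‖ - ‖v n‖), sq_nonneg ‖u n‖, sq_nonneg ‖v n‖])
    (hu.add hv)

theorem memLp_conj (hf : MemLp f 2 μ) : MemLp (fun z => starRingEnd ℂ (f z)) 2 μ :=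
  hf.of_le (Complex.continuous_conj.comp_aestronglyMeasurable hf.aestronglyMeasurable)
    (Eventually.of_forall fun z => by simp)

end Families

/-- The Fredholm series on `L²(a, ∞)` of the kernel
`∬ F(s) G(t) exp ((x - a) t - (y - a) s) / (s - t)` is that of the matrix
`2 ∬ F(s) G(t) cayley l (s - c) cayley k (c - t) / (s - t)`. Indeed the kernel is `∑ₗ hₗ(x) gₗ(y)`
and the matrix is `∫ gₗ hₖ`, with `gₗ` and `hₖ` the Laplace transforms of the two families of
functions. -/
theorem hasFredholmSeries_laplace {μ : Measure ℂ} [SFinite μ] {δ b : ℝ} (hδb : δ < b) (a : ℝ)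
    {F G : ℂ → ℂ} (hF : Integrable F μ) (hG : Integrable G μ) (hFm : Measurable F)
    (hGm : Measurable G) (hFb : ∀ z, F z ≠ 0 → b ≤ z.re) (hGδ : ∀ z, G z ≠ 0 → z.re ≤ δ)
    {K : ℝ → ℝ → ℂ} (hK : ∀ x y, a < x → a < y → K x y =
      ∫ s, F s * Complex.exp (-((y - a : ℝ) : ℂ) * s) *
        ∫ t, G t * Complex.exp (((x - a : ℝ) : ℂ) * t) / (s - t) ∂μ ∂μ) :
    HasFredholmSeries K a (fredholmSum fun l k =>
      2 * ∫ s, F s * cayley l (s - ((δ + b) / 2 : ℝ)) *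
        ∫ t, G t * cayley k (((δ + b) / 2 : ℝ) - t) / (s - t) ∂μ ∂μ) := by
  set c : ℝ := (δ + b) / 2 with hc
  set ε : ℝ := (b - δ) / 2
  have hε : 0 < ε := by simp only [ε]; linarith
  have hκ₁ : Measurable fun z : ℂ => (c : ℂ) - z := by fun_prop
  have hκ₂ : Measurable fun z : ℂ => z - (c : ℂ) := by fun_prop
  have hF' : ∀ z, F z ≠ 0 → ε ≤ (z - (c : ℂ)).re := fun z hz => by
    have := hFb z hz
    simp [c, ε]; linarith
  have hG' : ∀ z, G z ≠ 0 → ε ≤ ((c : ℂ) - z).re := fun z hz => by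
    have := hGδ z hz
    simp [c, ε]; linarith
  have hFi : ∀ l, Integrable (fun s => F s * cayley l (s - c)) μ :=
    integrable_mul_cayley hκ₂ hε hF hF'
  have hGi : ∀ l, Integrable (fun t => G t * cayley l (c - t)) μ :=
    integrable_mul_cayley hκ₁ hε hG hG'
  -- the exponents are frozen below `a`, so that the bounds hold on the whole line
  set ξ : ℝ → ℝ := fun x => max (x - a) 0
  have hξ0 : ∀ x, 0 ≤ ξ x := fun x => le_max_right _ _
  have hξ : ∀ x, a < x → ξ x = x - a := fun x hx => max_eq_left (by linarith)
  have hFexp : ∀ x s, ‖F s * Complex.exp (-(ξ x : ℂ) * s)‖ ≤ Real.exp (-b * ξ x) * ‖F s‖ := by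
    intro x s
    rw [norm_mul, mul_comm]
    by_cases h0 : F s = 0
    · simp [h0]
    · refine mul_le_mul_of_nonneg_right ?_ (norm_nonneg _)
      rw [Complex.norm_exp, Real.exp_le_exp, ← Complex.ofReal_neg, Complex.re_ofReal_mul]
      nlinarith [hFb s h0, hξ0 x]
  have hGexp : ∀ x t, ‖G t * Complex.exp ((ξ x : ℂ) * t)‖ ≤ Real.exp (δ * ξ x) * ‖G t‖ := by
    intro x t
    rw [norm_mul, mul_comm]
    by_cases h0 : G t = 0
    · simp [h0]
    · refine mul_le_mul_of_nonneg_right ?_ (norm_nonneg _)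
      rw [Complex.norm_exp, Real.exp_le_exp, Complex.re_ofReal_mul]
      nlinarith [hGδ t h0, hξ0 x]
  have hFx : ∀ x, Integrable (fun s => F s * Complex.exp (-(ξ x : ℂ) * s)) μ := fun x =>
    (hF.norm.const_mul _).mono' (by fun_prop) (Eventually.of_forall (hFexp x))
  have hGx : ∀ x, Integrable (fun t => G t * Complex.exp ((ξ x : ℂ) * t)) μ := fun x =>
    (hG.norm.const_mul _).mono' (by fun_prop) (Eventually.of_forall (hGexp x))
  set g : ℕ → ℝ → ℂ := fun l x => ∫ s, F s * Complex.exp (-(ξ x : ℂ) * s) * cayley l (s - c) ∂μ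
  set h : ℕ → ℝ → ℂ := fun l x =>
    2 * ∫ t, G t * Complex.exp ((ξ x : ℂ) * t) * cayley l (c - t) ∂μ
  set K' : ℝ → ℝ → ℂ := fun x y => 2 * ∫ s, F s * Complex.exp (-(ξ y : ℂ) * s) *
    ∫ t, G t * Complex.exp ((ξ x : ℂ) * t) / (2 * (s - t)) ∂μ ∂μ
  have hgm : ∀ l, Measurable (g l) := fun l => by
    have hm : Measurable (Function.uncurry fun (x : ℝ) (s : ℂ) =>
        F s * Complex.exp (-(ξ x : ℂ) * s) * cayley l (s - c)) := by
      simp only [Function.uncurry_def, ξ]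
      fun_prop
    exact (hm.stronglyMeasurable.integral_prod_right (ν := μ)).measurable
  have hhm : ∀ l, Measurable (h l) := fun l => by
    have hm : Measurable (Function.uncurry fun (x : ℝ) (t : ℂ) =>
        G t * Complex.exp ((ξ x : ℂ) * t) * cayley l (c - t)) := by
      simp only [Function.uncurry_def, ξ]
      fun_prop
    exact (hm.stronglyMeasurable.integral_prod_right (ν := μ)).measurable.const_mul 2
  have hgb : ∀ l x, ‖g l x‖ ≤ (∫ s, ‖F s * cayley l (s - c)‖ ∂μ) * Real.exp (-b * ξ x) := by
    intro l x
    rw [mul_comm, ← integral_const_mul]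
    refine norm_integral_le_of_norm_le ((hFi l).norm.const_mul _) (Eventually.of_forall fun s => ?_)
    rw [norm_mul, norm_mul (F s) (cayley _ _), ← mul_assoc]
    exact mul_le_mul_of_nonneg_right (hFexp x s) (norm_nonneg _)
  have hhb : ∀ l x, ‖h l x‖ ≤ Real.exp (δ * ξ x) * (2 * ∫ t, ‖G t * cayley l (c - t)‖ ∂μ) := by
    intro l x
    simp only [h]
    rw [norm_mul, Complex.norm_ofNat, mul_left_comm, ← integral_const_mul]
    refine mul_le_mul_of_nonneg_left ?_ zero_le_two
    refine norm_integral_le_of_norm_le ((hGi l).norm.const_mul _) (Eventually.of_forall fun s => ?_)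
    rw [norm_mul, norm_mul (G s) (cayley _ _), ← mul_assoc]
    exact mul_le_mul_of_nonneg_right (hGexp x s) (norm_nonneg _)
  have hA : IntegrableOn (fun x => Real.exp (δ * ξ x) * Real.exp (-b * ξ x)) (Set.Ioi a) := by
    have := (exp_neg_integrableOn_Ioi a (sub_pos.2 hδb)).mul_const (Real.exp ((b - δ) * a))
    refine this.congr ?_
    filter_upwards [ae_restrict_mem measurableSet_Ioi] with x hx
    rw [hξ x hx, ← Real.exp_add, ← Real.exp_add]
    congr 1
    ring
  have hab : Summable fun l => (∫ s, ‖F s * cayley l (s - c)‖ ∂μ) *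
      (2 * ∫ t, ‖G t * cayley l (c - t)‖ ∂μ) := by
    refine Summable.of_nonneg_of_le (fun n => by positivity) (fun n => ?_)
      ((summable_sq_integral_mul_norm_cayley hκ₁ hε hG hG').add
        (summable_sq_integral_mul_norm_cayley hκ₂ hε hF hF'))
    nlinarith [sq_nonneg ((∫ t, ‖G t * cayley n (c - t)‖ ∂μ) -
        ∫ s, ‖F s * cayley n (s - c)‖ ∂μ)]
  have hKsum : ∀ x y, HasSum (fun l => h l x * g l y) (K' x y) := by
    intro x y
    have := (hasSum_integral_mul_integral hδb (hFx y) (hGx x)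
      (fun z hz => hFb z (left_ne_zero_of_mul hz))
      (fun z hz => hGδ z (left_ne_zero_of_mul hz))).mul_left 2
    convert! this using 2 with l
    simp only [h, g]
    ring
  have hE : ∀ l k, ∫ x in Set.Ioi a, g l x * h k x =
      2 * ∫ s, F s * cayley l (s - c) * ∫ t, G t * cayley k (c - t) / (s - t) ∂μ ∂μ := by
    intro l k
    rw [← integral_laplace_mul_laplace hδb a (hFi l) (hGi k)
      (fun z hz => hFb z (left_ne_zero_of_mul hz)) (fun z hz => hGδ z (left_ne_zero_of_mul hz)),
      ← integral_const_mul]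
    refine setIntegral_congr_fun measurableSet_Ioi fun x hx => ?_
    simp only [g, h]
    rw [hξ x hx]
    simp only [mul_right_comm _ (Complex.exp _)]
    ring
  have hKK' : ∀ x y, a < x → a < y → K x y = K' x y := by
    intro x y hx hy
    simp only [K']
    rw [hK x y hx hy, hξ x hx, hξ y hy, ← integral_const_mul]
    refine integral_congr_ae (Eventually.of_forall fun s => ?_)
    simp only
    rw [mul_left_comm, ← integral_const_mul 2]
    congr 2
    ext t
    by_cases h0 : s - t = 0
    · simp [h0]
    · field_simp
  obtain ⟨hint, hsum⟩ := hasSum_fredholm_of_hasSum_mul (μ := volume.restrict (Set.Ioi a)) hgm hhm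
    hgb hhb hA (fun x => (Real.exp_pos _).le) (fun x => (Real.exp_pos _).le)
    (fun l => integral_nonneg fun _ => norm_nonneg _) (fun l => by positivity) hab hKsum
  simp_rw [hE] at hsum
  have hdet : ∀ n : ℕ, Set.EqOn (fun x : Fin n → ℝ => (Matrix.of fun j k => K' (x j) (x k)).det)
      (fun x : Fin n → ℝ => (Matrix.of fun j k => K (x j) (x k)).det)
      (Set.univ.pi fun _ => Set.Ioi a) := by
    intro n x hx
    simp only
    congr 2
    ext j k
    exact (hKK' _ _ (hx j trivial) (hx k trivial)).symm
  have hmeas : ∀ n : ℕ, MeasurableSet (Set.univ.pi fun _ : Fin n => Set.Ioi a) :=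
    fun n => MeasurableSet.univ_pi fun _ => measurableSet_Ioi
  have hpi : ∀ n : ℕ, (Measure.pi fun _ : Fin n => volume.restrict (Set.Ioi a)) =
      volume.restrict (Set.univ.pi fun _ : Fin n => Set.Ioi a) := fun n => by
    rw [volume_pi, Measure.restrict_pi_pi]
  simp_rw [hpi] at hint hsum
  refine ⟨fun n => (integrableOn_congr_fun (hdet n) (hmeas n)).1 (hint n), ?_⟩
  simp_rw [← fun n => setIntegral_congr_fun (μ := volume) (hmeas n) (hdet n)]
  exact hsum

/-- Let `μ` be a measure on the plane, let `f₁, f₃` be weights supported in `Re z ≤ δ` and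
`f₂, f₄` weights supported in `Re z ≥ b > δ`. The integral operator on `L²(μ)` with kernel
`f₂(x) f₁(y) / (x - y) + f₃(x) f₄(y) / (y - x)` is of trace class, and its Fredholm determinant is
the Fredholm series on `L²(a, ∞)` of the kernel
`∬ f₄(s) f₂(s) f₁(t) f₃(t) exp ((x - a) t - (y - a) s) / (s - t)`.

Expanding the Cauchy kernel makes the operator off-diagonal in rank-one operators indexed by
`ℕ ⊕ ℕ`. Its determinant is that of the matrix `⟨gₗ, hₖ⟩`, where `gₗ`, `hₖ` are Laplace transforms
on `(a, ∞)`, and cyclicity turns this into the determinant of the kernel `∑ₗ hₗ(x) gₗ(y)`. -/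
theorem exists_hasFredholmDet_twoContour {μ : Measure ℂ} [SFinite μ] {δ b : ℝ} (hδb : δ < b) (a : ℝ)
    {f₁ f₂ f₃ f₄ : ℂ → ℂ} (hf₁ : MemLp f₁ 2 μ) (hf₂ : MemLp f₂ 2 μ) (hf₃ : MemLp f₃ 2 μ)
    (hf₄ : MemLp f₄ 2 μ) (hm₁ : Measurable f₁) (hm₂ : Measurable f₂) (hm₃ : Measurable f₃)
    (hm₄ : Measurable f₄) (h₁ : ∀ z, f₁ z ≠ 0 → z.re ≤ δ) (h₂ : ∀ z, f₂ z ≠ 0 → b ≤ z.re)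
    (h₃ : ∀ z, f₃ z ≠ 0 → z.re ≤ δ) (h₄ : ∀ z, f₄ z ≠ 0 → b ≤ z.re) :
    ∃ (Q : Lp ℂ 2 μ →L[ℂ] Lp ℂ 2 μ) (d : ℂ),
      (∀ f : Lp ℂ 2 μ, ∀ᵐ x ∂μ,
        (x.re ≤ δ → Q f x = f₃ x * ∫ y, f₄ y * f y / (y - x) ∂μ) ∧
        (b ≤ x.re → Q f x = f₂ x * ∫ y, f₁ y * f y / (x - y) ∂μ)) ∧
      HasFredholmDet Q d ∧
      ∀ K : ℝ → ℝ → ℂ, (∀ x y, a < x → a < y → K x y =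
          ∫ s, f₄ s * f₂ s * Complex.exp (-((y - a : ℝ) : ℂ) * s) *
            ∫ t, f₁ t * f₃ t * Complex.exp (((x - a : ℝ) : ℂ) * t) / (s - t) ∂μ ∂μ) →
        HasFredholmSeries K a d := by
  set c : ℝ := (δ + b) / 2
  set ε : ℝ := (b - δ) / 2
  have hε : 0 < ε := by simp only [ε]; linarith
  have hκ₁ : Measurable fun z : ℂ => (c : ℂ) - z := by fun_prop
  have hκ₂ : Measurable fun z : ℂ => z - (c : ℂ) := by fun_prop
  have hκ₁' : Measurable fun z : ℂ => starRingEnd ℂ ((c : ℂ) - z) :=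
    Complex.continuous_conj.measurable.comp hκ₁
  have hκ₂' : Measurable fun z : ℂ => starRingEnd ℂ (z - (c : ℂ)) :=
    Complex.continuous_conj.measurable.comp hκ₂
  have hl : ∀ z : ℂ, z.re ≤ δ → ε ≤ ((c : ℂ) - z).re := fun z hz => by simp [c, ε]; linarith
  have hr : ∀ z : ℂ, b ≤ z.re → ε ≤ (z - (c : ℂ)).re := fun z hz => by simp [c, ε]; linarith
  -- `Q = ∑ⱼ ⟪uⱼ, ·⟫ vⱼ`, with `j` in `ℕ ⊕ ℕ`; the weights of `uⱼ` are conjugated because the inner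
  -- product is conjugate linear in its first argument
  have hs₁ : ∀ z, starRingEnd ℂ (f₁ z) ≠ 0 → ε ≤ (starRingEnd ℂ ((c : ℂ) - z)).re := fun z hz => by
    simpa using hl z (h₁ z (by simpa using hz))
  have hs₄ : ∀ z, starRingEnd ℂ (f₄ z) ≠ 0 → ε ≤ (starRingEnd ℂ (z - (c : ℂ))).re := fun z hz => by
    simpa using hr z (h₄ z (by simpa using hz))
  have hs₂ : ∀ z, 2 * f₂ z ≠ 0 → ε ≤ (z - (c : ℂ)).re := fun z hz =>
    hr z (h₂ z (right_ne_zero_of_mul hz))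
  have hs₃ : ∀ z, 2 * f₃ z ≠ 0 → ε ≤ ((c : ℂ) - z).re := fun z hz =>
    hl z (h₃ z (right_ne_zero_of_mul hz))
  set u₁ := cayleyVec hκ₁' hε (memLp_conj hf₁) hs₁
  set u₂ := cayleyVec hκ₂' hε (memLp_conj hf₄) hs₄
  set v₁ := cayleyVec hκ₂ hε (hf₂.const_mul 2) hs₂
  set v₂ := cayleyVec hκ₁ hε (hf₃.const_mul 2) hs₃
  set u : ℕ ⊕ ℕ → Lp ℂ 2 μ := Sum.elim u₁ u₂
  set v : ℕ ⊕ ℕ → Lp ℂ 2 μ := Sum.elim v₁ v₂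
  have huv : Summable fun j => ‖u j‖ * ‖v j‖ := by
    refine Summable.sum _ ?_ ?_
    · exact summable_norm_mul_norm_of_sq
        (summable_sq_norm_cayleyVec hκ₁' hε (memLp_conj hf₁) hs₁)
        (summable_sq_norm_cayleyVec hκ₂ hε (hf₂.const_mul 2) hs₂)
    · exact summable_norm_mul_norm_of_sq
        (summable_sq_norm_cayleyVec hκ₂' hε (memLp_conj hf₄) hs₄)
        (summable_sq_norm_cayleyVec hκ₁ hε (hf₃.const_mul 2) hs₃)
  have hinner₁ : ∀ n (g : Lp ℂ 2 μ), inner ℂ (u₁ n) g = ∫ z, f₁ z * g z * cayley n (c - z) ∂μ := by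
    intro n g
    simp only [u₁, cayleyVec]
    rw [inner_toLp_eq_integral]
    refine integral_congr_ae (Eventually.of_forall fun z => ?_)
    simp only [cayley_conj, map_mul, Complex.conj_conj]
    ring
  have hinner₂ : ∀ n (g : Lp ℂ 2 μ), inner ℂ (u₂ n) g = ∫ z, f₄ z * g z * cayley n (z - c) ∂μ := by
    intro n g
    simp only [u₂, cayleyVec]
    rw [inner_toLp_eq_integral]
    refine integral_congr_ae (Eventually.of_forall fun z => ?_)
    simp only [cayley_conj, map_mul, Complex.conj_conj]
    ring
  obtain ⟨Q, hQ⟩ := exists_hasSum_rankOne huv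
  refine ⟨Q, _, fun f => ?_, hasFredholmDet_of_hasSum Equiv.natSumNatEquivNat.symm huv hQ, ?_⟩
  · have hφ : ∀ j : ℕ ⊕ ℕ, (inner ℂ (u j) f • v j : Lp ℂ 2 μ) =ᵐ[μ]
        fun x => Sum.elim (fun n => inner ℂ (u₁ n) f * (2 * f₂ x * cayley n (x - c)))
          (fun n => inner ℂ (u₂ n) f * (2 * f₃ x * cayley n (c - x))) j := by
      rintro (n | n)
      · filter_upwards [Lp.coeFn_smul (inner ℂ (u₁ n) f) (v₁ n),
          coeFn_cayleyVec hκ₂ hε (hf₂.const_mul 2) hs₂ n] with x hx hx'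
        simp only [u, v, Sum.elim_inl]
        rw [hx, Pi.smul_apply, hx', smul_eq_mul]
      · filter_upwards [Lp.coeFn_smul (inner ℂ (u₂ n) f) (v₂ n),
          coeFn_cayleyVec hκ₁ hε (hf₃.const_mul 2) hs₃ n] with x hx hx'
        simp only [u, v, Sum.elim_inr]
        rw [hx, Pi.smul_apply, hx', smul_eq_mul]
    have hi₁ : Integrable (fun z => f₁ z * f z) μ := hf₁.integrable_mul (Lp.memLp f)
    have hi₄ : Integrable (fun z => f₄ z * f z) μ := hf₄.integrable_mul (Lp.memLp f)
    filter_upwards [ae_eq_of_hasSum_L2 Equiv.natSumNatEquivNat.symm (hQ f) hφ] with x hx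
    refine ⟨fun hxδ => hx _ ?_, fun hxb => hx _ ?_⟩
    · have h0 : f₂ x = 0 := by
        by_contra h
        linarith [h₂ x h]
      have h := hasSum_cayley_mul_integral hκ₂ hε hi₄
        (fun z hz => hr z (h₄ z (left_ne_zero_of_mul hz))) (hε.trans_le (hl x hxδ))
      rw [← zero_add (f₃ x * _)]
      refine HasSum.sum ?_ ?_
      · simp [Function.comp_def, h0, hasSum_zero]
      · convert! h.mul_left (2 * f₃ x) using 1
        · ext n
          simp only [Function.comp_apply, Sum.elim_inr, hinner₂]
          ring
        · rw [mul_comm 2, mul_assoc, ← integral_const_mul 2]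
          congr 2
          ext y
          rw [show (c : ℂ) - x + (y - c) = y - x by ring]
          by_cases h : y - x = 0
          · simp [h]
          · field_simp
    · have h0 : f₃ x = 0 := by
        by_contra h
        linarith [h₃ x h]
      have h := hasSum_cayley_mul_integral hκ₁ hε hi₁
        (fun z hz => hl z (h₁ z (left_ne_zero_of_mul hz))) (hε.trans_le (hr x hxb))
      rw [← add_zero (f₂ x * _)]
      refine HasSum.sum ?_ ?_
      · convert! h.mul_left (2 * f₂ x) using 1
        · ext n
          simp only [Function.comp_apply, Sum.elim_inl, hinner₁]
          ring
        · rw [mul_comm 2, mul_assoc, ← integral_const_mul 2]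
          congr 2
          ext y
          rw [show x - (c : ℂ) + (c - y) = x - y by ring]
          by_cases h : x - y = 0
          · simp [h]
          · field_simp
      · simp [Function.comp_def, h0, hasSum_zero]
  · intro K hK
    have hF : Integrable (fun s => f₄ s * f₂ s) μ := hf₄.integrable_mul hf₂
    have hG : Integrable (fun t => f₁ t * f₃ t) μ := hf₁.integrable_mul hf₃
    have hFb : ∀ z, f₄ z * f₂ z ≠ 0 → b ≤ z.re := fun z hz => h₄ z (left_ne_zero_of_mul hz)
    have hGδ : ∀ z, f₁ z * f₃ z ≠ 0 → z.re ≤ δ := fun z hz => h₁ z (left_ne_zero_of_mul hz)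
    have hmat : (fredholmSum fun i j => inner ℂ (u i) (v j)) = fredholmSum fun l k =>
        2 * ∫ s, f₄ s * f₂ s * cayley l (s - c) *
          ∫ t, f₁ t * f₃ t * cayley k (c - t) / (s - t) ∂μ ∂μ := by
      rw [fredholmSum_offDiagonal (fun j => norm_nonneg (u j)) (fun j => norm_nonneg (v j)) huv
        (fun i j => norm_inner_le_norm _ _)]
      · congr 1
        ext l k
        simp only [u, v, Sum.elim_inl, Sum.elim_inr]
        -- summing over the inner index restores the Cauchy kernel between the outer functions
        have := (hasSum_integral_mul_integral hδb (integrable_mul_cayley hκ₂ hε hF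
          (fun z hz => hr z (hFb z hz)) l) (integrable_mul_cayley hκ₁ hε hG
          (fun z hz => hl z (hGδ z hz)) k) (fun z hz => hFb z (left_ne_zero_of_mul hz))
          (fun z hz => hGδ z (left_ne_zero_of_mul hz))).mul_left 4
        have h2 : 2 * ∫ s, f₄ s * f₂ s * cayley l (s - c) *
            ∫ t, f₁ t * f₃ t * cayley k (c - t) / (s - t) ∂μ ∂μ =
            4 * ∫ s, f₄ s * f₂ s * cayley l (s - c) *
              ∫ t, f₁ t * f₃ t * cayley k (c - t) / (2 * (s - t)) ∂μ ∂μ := by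
          rw [← integral_const_mul, ← integral_const_mul]
          refine integral_congr_ae (Eventually.of_forall fun s => ?_)
          simp only
          rw [mul_left_comm, mul_left_comm 4, ← integral_const_mul 2, ← integral_const_mul 4]
          refine congrArg _ (integral_congr_ae (Eventually.of_forall fun t => ?_))
          by_cases h0 : s - t = 0
          · simp [h0]
          · field_simp
            ring
        rw [h2, ← this.tsum_eq]
        refine tsum_congr fun n => ?_
        have h3 : inner ℂ (u₂ l) (v₁ n) =
            2 * ∫ s, f₄ s * f₂ s * cayley l (s - c) * cayley n (s - c) ∂μ := by
          rw [hinner₂, ← integral_const_mul]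
          refine integral_congr_ae ?_
          filter_upwards [coeFn_cayleyVec hκ₂ hε (hf₂.const_mul 2) hs₂ n] with s hs
          rw [hs]
          ring
        have h4 : inner ℂ (u₁ n) (v₂ k) =
            2 * ∫ t, f₁ t * f₃ t * cayley k (c - t) * cayley n (c - t) ∂μ := by
          rw [hinner₁, ← integral_const_mul]
          refine integral_congr_ae ?_
          filter_upwards [coeFn_cayleyVec hκ₁ hε (hf₃.const_mul 2) hs₃ k] with t ht
          rw [ht]
          ring
        rw [h3, h4]
        ring
      · intro i j
        simp only [u, v, Sum.elim_inl]
        rw [hinner₁]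
        refine integral_eq_zero_of_ae ?_
        filter_upwards [coeFn_cayleyVec hκ₂ hε (hf₂.const_mul 2) hs₂ j] with z hz
        rw [hz]
        by_cases h0 : f₁ z = 0
        · simp [h0]
        · have h5 : f₂ z = 0 := by
            by_contra h6
            linarith [h₁ z h0, h₂ z h6]
          simp [h5]
      · intro i j
        simp only [u, v, Sum.elim_inr]
        rw [hinner₂]
        refine integral_eq_zero_of_ae ?_
        filter_upwards [coeFn_cayleyVec hκ₁ hε (hf₃.const_mul 2) hs₃ j] with z hz
        rw [hz]
        by_cases h0 : f₃ z = 0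
        · simp [h0]
        · have h5 : f₄ z = 0 := by
            by_contra h6
            linarith [h₃ z h0, h₄ z h6]
          simp [h5]
    rw [hmat]
    exact hasFredholmSeries_laplace hδb a hF hG (hm₄.mul hm₂) (hm₁.mul hm₃) hFb hGδ hK

/-! ### Growth of the Gamma function along the contours -/

theorem norm_Gamma_le_Gamma_re {s : ℂ} (hs : 0 < s.re) : ‖Complex.Gamma s‖ ≤ Real.Gamma s.re := by
  rw [Complex.Gamma_eq_integral hs, Real.Gamma_eq_integral hs, Complex.GammaIntegral]
  refine norm_integral_le_of_norm_le (Real.GammaIntegral_convergent hs) ?_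
  filter_upwards [ae_restrict_mem measurableSet_Ioi] with x hx
  rw [norm_mul, Complex.norm_of_nonneg (Real.exp_pos (-x)).le,
    Complex.norm_cpow_eq_rpow_re_of_pos hx]
  simp

/-- The Gamma function grows at most exponentially to the left, away from its poles. -/
theorem exists_norm_Gamma_le {η M : ℝ} (hη : 0 < η) :
    ∃ C L : ℝ, 0 < C ∧ 0 ≤ L ∧ ∀ t : ℂ, t.re ≤ M → (∀ j : ℕ, η ≤ ‖t + j‖) →
      ‖Complex.Gamma t‖ ≤ C * Real.exp (L * |t.re|) := by
  -- with `M ≥ 1` and `η ≤ 1`, each step of `Γ(t) = Γ(t + 1) / t` costs a factor `η⁻¹`, and after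
  -- about `|Re t|` steps the argument has real part in `[1, M + 1]`
  set M' := max M 1
  set η' := min η 1
  have hη' : 0 < η' := lt_min hη one_pos
  have hcont : ContinuousOn Real.Gamma (Set.Icc 1 (M' + 1)) := fun x hx =>
    (Real.differentiableAt_Gamma fun m => by
      have := hx.1
      have h2 : (0 : ℝ) ≤ m := Nat.cast_nonneg m
      linarith).continuousAt.continuousWithinAt
  obtain ⟨C₀, hC₀⟩ := isCompact_Icc.bddAbove_image hcont
  set C := max C₀ 1
  have hC : 0 < C := lt_of_lt_of_le one_pos (le_max_right _ _)
  have hΓ : ∀ x ∈ Set.Icc 1 (M' + 1), Real.Gamma x ≤ C := fun x hx =>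
    (hC₀ (Set.mem_image_of_mem _ hx)).trans (le_max_left _ _)
  have hrec : ∀ t : ℂ, (∀ j : ℕ, η ≤ ‖t + j‖) →
      ‖Complex.Gamma t‖ ≤ ‖Complex.Gamma (t + 1)‖ * η'⁻¹ := by
    intro t ht
    have ht0 : η' ≤ ‖t‖ := (min_le_left _ _).trans (by simpa using ht 0)
    have hne : t ≠ 0 := norm_pos_iff.1 (hη'.trans_le ht0)
    rw [Complex.Gamma_add_one t hne, norm_mul]
    rw [mul_comm ‖t‖, mul_assoc]
    refine le_mul_of_one_le_right (norm_nonneg _) ?_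
    rw [← div_eq_mul_inv]
    exact (one_le_div hη').2 ht0
  have hind : ∀ n : ℕ, ∀ t : ℂ, t.re ≤ M' → -(n : ℝ) ≤ t.re → (∀ j : ℕ, η ≤ ‖t + j‖) →
      ‖Complex.Gamma t‖ ≤ C * η'⁻¹ ^ (n + 1) := by
    intro n
    induction n with
    | zero =>
      intro t htM ht0 ht
      have h0 : 0 ≤ t.re := by simpa using ht0
      refine (hrec t ht).trans ?_
      rw [zero_add, pow_one]
      refine mul_le_mul_of_nonneg_right ?_ (inv_nonneg.2 hη'.le)
      refine (norm_Gamma_le_Gamma_re (by simp; linarith)).trans (hΓ _ ⟨?_, ?_⟩) <;> simp <;>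
        linarith
    | succ n ih =>
      intro t htM htn ht
      have h1 : 1 ≤ η'⁻¹ := (one_le_inv₀ hη').2 (min_le_right _ _)
      by_cases h : -(n : ℝ) ≤ t.re
      · refine (ih t htM h ht).trans ?_
        gcongr
        omega
      · push Not at h
        refine (hrec t ht).trans ?_
        rw [pow_succ _ (n + 1), ← mul_assoc]
        refine mul_le_mul_of_nonneg_right (ih (t + 1) ?_ ?_ fun j => ?_) (inv_nonneg.2 hη'.le)
        · have : (1 : ℝ) ≤ M' := le_max_right _ _
          have h2 : (0 : ℝ) ≤ n := Nat.cast_nonneg n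
          simp
          linarith
        · push_cast at htn
          simp
          linarith
        · have := ht (j + 1)
          push_cast at this
          rwa [add_assoc, add_comm (1 : ℂ)]
  have hL : 0 ≤ Real.log η'⁻¹ := Real.log_nonneg ((one_le_inv₀ hη').2 (min_le_right _ _))
  refine ⟨C * Real.exp (2 * Real.log η'⁻¹), Real.log η'⁻¹, by positivity, hL, fun t htM ht => ?_⟩
  have hn := hind ⌈|t.re|⌉₊ t (htM.trans (le_max_left _ _)) (by
    have := Nat.le_ceil |t.re|
    have h2 := neg_abs_le t.re
    linarith) ht
  refine hn.trans ?_
  rw [mul_assoc, ← Real.exp_add]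
  refine mul_le_mul_of_nonneg_left ?_ hC.le
  rw [← Real.exp_log (inv_pos.2 hη'), ← Real.exp_nat_mul, Real.exp_le_exp, Real.log_exp]
  have := (Nat.ceil_lt_add_one (abs_nonneg t.re)).le
  push_cast
  nlinarith

theorem norm_sin_le_exp_abs_im (z : ℂ) : ‖Complex.sin z‖ ≤ Real.exp |z.im| := by
  rw [Complex.sin, norm_div, norm_mul, Complex.norm_I, mul_one, Complex.norm_ofNat]
  have h1 : ‖Complex.exp (-z * Complex.I)‖ ≤ Real.exp |z.im| := by
    rw [Complex.norm_exp, Real.exp_le_exp]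
    simpa using le_abs_self z.im
  have h2 : ‖Complex.exp (z * Complex.I)‖ ≤ Real.exp |z.im| := by
    rw [Complex.norm_exp, Real.exp_le_exp]
    simpa using neg_le_abs z.im
  have := (norm_sub_le (Complex.exp (-z * Complex.I)) (Complex.exp (z * Complex.I)))
  rw [div_le_iff₀ two_pos]
  linarith

/-- The reciprocal of the Gamma function grows at most exponentially on vertical lines: by the
reflection formula away from the real axis, and by compactness near it. -/
theorem exists_norm_inv_Gamma_le (b : ℝ) :
    ∃ C L : ℝ, 0 < C ∧ 0 ≤ L ∧ ∀ r : ℝ,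
      ‖(Complex.Gamma (b + r * Complex.I))⁻¹‖ ≤ C * Real.exp (L * |r|) := by
  obtain ⟨C₁, L₁, hC₁, hL₁, h₁⟩ := exists_norm_Gamma_le (η := 1) (M := 1 - b) one_pos
  have hcont : Continuous fun r : ℝ => (Complex.Gamma (b + r * Complex.I))⁻¹ :=
    Complex.differentiable_one_div_Gamma.continuous.comp (by fun_prop)
  obtain ⟨C₂, hC₂⟩ := (isCompact_Icc (a := (-1 : ℝ)) (b := 1)).exists_bound_of_continuousOn
    hcont.continuousOn
  set C₃ := C₁ * Real.exp (L₁ * |1 - b|)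
  refine ⟨max C₂ C₃, Real.pi, lt_of_lt_of_le (by positivity) (le_max_right _ _), Real.pi_pos.le,
    fun r => ?_⟩
  have hpos : 0 < max C₂ C₃ := lt_of_lt_of_le (by positivity) (le_max_right _ _)
  by_cases hr : |r| ≤ 1
  · refine (hC₂ r (abs_le.1 hr)).trans ((le_max_left _ C₃).trans ?_)
    exact le_mul_of_one_le_right hpos.le (Real.one_le_exp (by positivity))
  · push Not at hr
    set z : ℂ := b + r * Complex.I
    have hzre : z.re = b := by simp [z]
    have hzim : z.im = r := by simp [z]
    have hpi : (Real.pi : ℂ) ≠ 0 := Complex.ofReal_ne_zero.2 Real.pi_ne_zero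
    have hrefl := Complex.Gamma_mul_Gamma_one_sub z
    have hsin : Complex.sin (Real.pi * z) ≠ 0 := by
      rw [Complex.sin_ne_zero_iff]
      intro k hk
      rw [mul_comm, mul_left_inj' hpi] at hk
      have := congrArg Complex.im hk
      rw [hzim, Complex.intCast_im] at this
      rw [this, abs_zero] at hr
      linarith
    have hΓ : (Complex.Gamma z)⁻¹ =
        Complex.Gamma (1 - z) * (Complex.sin (Real.pi * z) / Real.pi) := by
      have h0 : Complex.Gamma z ≠ 0 := fun h => by
        rw [h, zero_mul] at hrefl
        exact (div_ne_zero hpi hsin) hrefl.symm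
      field_simp
      rw [hrefl]
      field_simp
    have hb1 := h₁ (1 - z) (by simp [hzre]) fun j => by
      refine hr.le.trans ?_
      have := Complex.abs_im_le_norm (1 - z + j)
      simpa [hzim] using this
    have hb2 := norm_sin_le_exp_abs_im (Real.pi * z)
    rw [Complex.im_ofReal_mul, hzim, abs_mul, abs_of_pos Real.pi_pos] at hb2
    rw [hΓ, norm_mul, norm_div, Complex.norm_real, Real.norm_of_nonneg Real.pi_pos.le]
    have hre : (1 - z).re = 1 - b := by simp [hzre]
    rw [hre] at hb1
    calc _ ≤ C₃ * (Real.exp (Real.pi * |r|) / 1) := by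
          gcongr
          linarith [Real.pi_gt_three]
      _ ≤ _ := by
          rw [div_one]
          gcongr
          exact le_max_right _ _

/-! ### Gaussian weights -/

theorem memLp_two_of_norm_le_gaussian {f : ℝ → ℂ} (hf : AEStronglyMeasurable f volume) {C κ L : ℝ}
    (hκ : 0 < κ) (hb : ∀ r, ‖f r‖ ≤ C * Real.exp (-κ * r ^ 2 + L * |r|)) : MemLp f 2 volume := by
  rw [memLp_two_iff_integrable_sq_norm hf]
  have hg := (integrable_exp_neg_mul_sq hκ).const_mul (C ^ 2 * Real.exp (L ^ 2 / κ))
  refine hg.mono' (hf.norm.pow 2) (Eventually.of_forall fun r => ?_)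
  rw [Real.norm_of_nonneg (by positivity)]
  calc ‖f r‖ ^ 2 ≤ (C * Real.exp (-κ * r ^ 2 + L * |r|)) ^ 2 := by
        gcongr
        exact hb r
    _ = C ^ 2 * Real.exp (2 * (-κ * r ^ 2 + L * |r|)) := by
        rw [mul_pow, ← Real.exp_nat_mul]
        norm_num
    _ ≤ C ^ 2 * Real.exp (L ^ 2 / κ + -κ * r ^ 2) := by
        gcongr
        -- completing the square
        have h1 : L ^ 2 / κ * κ = L ^ 2 := div_mul_cancel₀ _ hκ.ne'
        have h2 : |r| ^ 2 = r ^ 2 := sq_abs r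
        have h3 : 0 ≤ (L / κ - |r|) ^ 2 := sq_nonneg _
        have h4 : κ * (L / κ - |r|) ^ 2 = L ^ 2 / κ - 2 * (L * |r|) + κ * r ^ 2 := by
          rw [← h2]
          field_simp
          ring
        nlinarith [mul_nonneg hκ.le h3]
    _ = _ := by rw [Real.exp_add]; ring

/-! ### Geometry of the contours -/

section Contours

variable {δ b : ℝ}

theorem gammaPath_of_le {r : ℝ} (hr : r ≤ -(Real.pi * δ / 2)) :
    gammaPath δ r = ((r + Real.pi * δ / 2 : ℝ) : ℂ) - δ * Complex.I := if_pos hr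

theorem gammaPath_of_mem {r : ℝ} (h₁ : -(Real.pi * δ / 2) < r) (h₂ : r ≤ Real.pi * δ / 2) :
    gammaPath δ r = δ * Complex.exp ((r / δ : ℝ) * Complex.I) := by
  rw [gammaPath, if_neg h₁.not_ge, if_pos h₂]

theorem gammaPath_of_lt (hδ : 0 < δ) {r : ℝ} (hr : Real.pi * δ / 2 < r) :
    gammaPath δ r = ((Real.pi * δ / 2 - r : ℝ) : ℂ) + δ * Complex.I := by
  have : 0 < Real.pi * δ / 2 := by positivity
  rw [gammaPath, if_neg (by linarith), if_neg hr.not_ge]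

theorem continuous_gammaPath (hδ : 0 < δ) : Continuous (gammaPath δ) := by
  unfold gammaPath
  refine Continuous.if_le (by fun_prop) (Continuous.if_le (by fun_prop) (by fun_prop)
    continuous_id continuous_const ?_) continuous_id continuous_const ?_
  · rintro r rfl
    have : Real.pi * δ / 2 / δ = Real.pi / 2 := by field_simp
    rw [this]
    push_cast
    rw [Complex.exp_pi_div_two_mul_I]
    simp
  · rintro r rfl
    have : 0 < Real.pi * δ / 2 := by positivity
    rw [if_pos (by linarith)]
    have : -(Real.pi * δ / 2) / δ = -(Real.pi / 2) := by field_simp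
    rw [this]
    push_cast
    rw [Complex.exp_mul_I, Complex.cos_neg, Complex.sin_neg, Complex.cos_pi_div_two,
      Complex.sin_pi_div_two]
    simp

theorem gammaPath_arc_re_im (r : ℝ) :
    ((δ : ℂ) * Complex.exp ((r / δ : ℝ) * Complex.I)).re = δ * Real.cos (r / δ) ∧
      ((δ : ℂ) * Complex.exp ((r / δ : ℝ) * Complex.I)).im = δ * Real.sin (r / δ) := by
  rw [Complex.re_ofReal_mul, Complex.im_ofReal_mul, Complex.exp_ofReal_mul_I_re,
    Complex.exp_ofReal_mul_I_im]
  exact ⟨rfl, rfl⟩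

theorem re_gammaPath_le (hδ : 0 < δ) (r : ℝ) : (gammaPath δ r).re ≤ δ := by
  by_cases h₁ : r ≤ -(Real.pi * δ / 2)
  · rw [gammaPath_of_le h₁]
    simp
    linarith
  by_cases h₂ : r ≤ Real.pi * δ / 2
  · rw [gammaPath_of_mem (not_le.1 h₁) h₂, (gammaPath_arc_re_im r).1]
    nlinarith [Real.cos_le_one (r / δ)]
  · rw [gammaPath_of_lt hδ (not_le.1 h₂)]
    simp
    linarith

theorem cos_nonneg_of_arc (hδ : 0 < δ) {r : ℝ} (h₁ : -(Real.pi * δ / 2) < r)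
    (h₂ : r ≤ Real.pi * δ / 2) : 0 ≤ Real.cos (r / δ) := by
  refine Real.cos_nonneg_of_mem_Icc ⟨?_, ?_⟩
  · rw [le_div_iff₀ hδ]
    linarith
  · rw [div_le_iff₀ hδ]
    linarith

/-- The contour `γ` keeps the distance `δ` from the poles of the Gamma function. -/
theorem le_norm_gammaPath_add (hδ : 0 < δ) (r : ℝ) (j : ℕ) : δ ≤ ‖gammaPath δ r + j‖ := by
  by_cases h₁ : r ≤ -(Real.pi * δ / 2)
  · refine le_trans ?_ (Complex.abs_im_le_norm _)
    rw [gammaPath_of_le h₁]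
    simp [le_abs_self]
  by_cases h₂ : r ≤ Real.pi * δ / 2
  · have h₃ := cos_nonneg_of_arc hδ (not_le.1 h₁) h₂
    rw [gammaPath_of_mem (not_le.1 h₁) h₂]
    refine le_of_sq_le_sq ?_ (norm_nonneg _)
    rw [Complex.sq_norm, Complex.normSq_apply, Complex.add_re, Complex.add_im,
      (gammaPath_arc_re_im r).1, (gammaPath_arc_re_im r).2, Complex.natCast_re, Complex.natCast_im]
    have hj : (0 : ℝ) ≤ j := Nat.cast_nonneg j
    have hp : 0 ≤ δ * Real.cos (r / δ) * j := by positivity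
    have hcs : δ ^ 2 = δ ^ 2 * Real.cos (r / δ) ^ 2 + δ ^ 2 * Real.sin (r / δ) ^ 2 := by
      rw [← mul_add, Real.cos_sq_add_sin_sq, mul_one]
    nlinarith [sq_nonneg (j : ℝ)]
  · refine le_trans ?_ (Complex.abs_im_le_norm _)
    rw [gammaPath_of_lt hδ (not_le.1 h₂)]
    simp [le_abs_self]

theorem abs_re_gammaPath_le (hδ : 0 < δ) (r : ℝ) :
    |(gammaPath δ r).re| ≤ |r| + (Real.pi * δ / 2 + δ) := by
  have hp : 0 < Real.pi * δ / 2 := by positivity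
  by_cases h₁ : r ≤ -(Real.pi * δ / 2)
  · rw [gammaPath_of_le h₁]
    simp only [Complex.sub_re, Complex.ofReal_re, Complex.mul_re, Complex.I_re, Complex.ofReal_im,
      mul_zero, zero_mul, sub_zero]
    refine (abs_add_le _ _).trans ?_
    rw [abs_of_pos hp]
    linarith
  by_cases h₂ : r ≤ Real.pi * δ / 2
  · rw [gammaPath_of_mem (not_le.1 h₁) h₂, (gammaPath_arc_re_im r).1, abs_mul, abs_of_pos hδ]
    nlinarith [Real.abs_cos_le_one (r / δ), abs_nonneg r]
  · rw [gammaPath_of_lt hδ (not_le.1 h₂)]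
    simp only [Complex.add_re, Complex.ofReal_re, Complex.mul_re, Complex.I_re, Complex.ofReal_im,
      mul_zero, zero_mul, sub_zero, add_zero]
    refine (abs_sub _ _).trans ?_
    rw [abs_of_pos hp]
    linarith

theorem le_re_sq_gammaPath (hδ : 0 < δ) (r : ℝ) :
    r ^ 2 / 2 - ((Real.pi * δ / 2) ^ 2 + δ ^ 2) ≤ ((gammaPath δ r) ^ 2).re := by
  have hp : 0 < Real.pi * δ / 2 := by positivity
  have hre : ∀ z : ℂ, (z ^ 2).re = z.re ^ 2 - z.im ^ 2 := fun z => by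
    rw [sq, Complex.mul_re]
    ring
  rw [hre]
  by_cases h₁ : r ≤ -(Real.pi * δ / 2)
  · rw [gammaPath_of_le h₁]
    simp
    nlinarith [sq_nonneg (r + 2 * (Real.pi * δ / 2))]
  by_cases h₂ : r ≤ Real.pi * δ / 2
  · rw [gammaPath_of_mem (not_le.1 h₁) h₂, (gammaPath_arc_re_im r).1, (gammaPath_arc_re_im r).2]
    have hr : r ^ 2 ≤ (Real.pi * δ / 2) ^ 2 := sq_le_sq' (not_le.1 h₁).le h₂
    have hs : (δ * Real.sin (r / δ)) ^ 2 ≤ δ ^ 2 := by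
      rw [mul_pow]
      nlinarith [Real.sin_sq_le_one (r / δ), sq_nonneg δ]
    nlinarith [sq_nonneg (δ * Real.cos (r / δ)), sq_nonneg r]
  · rw [gammaPath_of_lt hδ (not_le.1 h₂)]
    simp
    nlinarith [sq_nonneg (r - 2 * (Real.pi * δ / 2))]

/-- The unit tangent vector `dz / |dz|` of the contour `γ`, as a function of the point. -/
def gammaTangent (δ : ℝ) (z : ℂ) : ℂ :=
  if z.re < 0 then (if z.im < 0 then 1 else -1) else Complex.I * z / δ

theorem measurable_gammaTangent (δ : ℝ) : Measurable (gammaTangent δ) := by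
  unfold gammaTangent
  refine Measurable.ite (measurableSet_lt Complex.measurable_re measurable_const)
    (Measurable.ite (measurableSet_lt Complex.measurable_im measurable_const) measurable_const
      measurable_const) (by fun_prop)

theorem norm_gammaTangent_gammaPath_le (hδ : 0 < δ) (r : ℝ) :
    ‖gammaTangent δ (gammaPath δ r)‖ ≤ 1 := by
  have hp : 0 < Real.pi * δ / 2 := by positivity
  unfold gammaTangent
  split_ifs with h h'
  · simp
  · simp
  · push Not at h
    have hn : ‖gammaPath δ r‖ = δ := by
      by_cases h₁ : r ≤ -(Real.pi * δ / 2)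
      · rw [gammaPath_of_le h₁] at h ⊢
        have h0 : r + Real.pi * δ / 2 = 0 := by
          simp at h
          linarith
        rw [h0]
        simp [abs_of_pos hδ]
      by_cases h₂ : r ≤ Real.pi * δ / 2
      · rw [gammaPath_of_mem (not_le.1 h₁) h₂, norm_mul, Complex.norm_exp_ofReal_mul_I]
        simp [abs_of_pos hδ]
      · rw [gammaPath_of_lt hδ (not_le.1 h₂)] at h
        simp at h
        linarith
    rw [norm_div, norm_mul, Complex.norm_I, one_mul, hn, Complex.norm_real,
      Real.norm_of_nonneg hδ.le, div_self hδ.ne']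

theorem deriv_gammaPath_ae (hδ : 0 < δ) :
    ∀ᵐ r : ℝ, deriv (gammaPath δ) r = gammaTangent δ (gammaPath δ r) := by
  have hp : 0 < Real.pi * δ / 2 := by positivity
  have hnull : ∀ᵐ r : ℝ, r ∉ ({-(Real.pi * δ / 2), Real.pi * δ / 2} : Set ℝ) :=
    measure_eq_zero_iff_ae_notMem.1 ((Set.toFinite _).measure_zero _)
  filter_upwards [hnull] with r hr
  simp only [Set.mem_insert_iff, Set.mem_singleton_iff, not_or] at hr
  rcases lt_or_gt_of_ne hr.1 with h₁ | h₁
  · have he : gammaPath δ =ᶠ[𝓝 r] fun r => ((r + Real.pi * δ / 2 : ℝ) : ℂ) - δ * Complex.I := by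
      filter_upwards [eventually_lt_nhds h₁] with x hx using gammaPath_of_le hx.le
    have hd : HasDerivAt (fun r : ℝ => ((r + Real.pi * δ / 2 : ℝ) : ℂ) - δ * Complex.I) 1 r := by
      simpa using (((hasDerivAt_id r).add_const (Real.pi * δ / 2)).ofReal_comp).sub_const
        ((δ : ℂ) * Complex.I)
    rw [he.deriv_eq, hd.deriv, gammaPath_of_le h₁.le, gammaTangent, if_pos, if_pos]
    · simpa using hδ
    · simp
      linarith
  rcases lt_or_gt_of_ne hr.2 with h₂ | h₂
  · have he : gammaPath δ =ᶠ[𝓝 r] fun r => δ * Complex.exp ((r / δ : ℝ) * Complex.I) := by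
      filter_upwards [eventually_gt_nhds h₁, eventually_lt_nhds h₂] with x hx hx' using
        gammaPath_of_mem hx hx'.le
    have hd : HasDerivAt (fun r : ℝ => (δ : ℂ) * Complex.exp ((r / δ : ℝ) * Complex.I))
        (δ * (Complex.exp ((r / δ : ℝ) * Complex.I) * (((1 / δ : ℝ) : ℂ) * Complex.I))) r :=
      (((((hasDerivAt_id r).div_const δ).ofReal_comp).mul_const Complex.I).cexp).const_mul (δ : ℂ)
    rw [he.deriv_eq, hd.deriv, gammaPath_of_mem h₁ h₂.le, gammaTangent, if_neg]
    · have : (δ : ℂ) ≠ 0 := Complex.ofReal_ne_zero.2 hδ.ne'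
      push_cast
      field_simp
    · rw [(gammaPath_arc_re_im r).1, not_lt]
      exact mul_nonneg hδ.le (cos_nonneg_of_arc hδ h₁ h₂.le)
  · have he : gammaPath δ =ᶠ[𝓝 r] fun r => ((Real.pi * δ / 2 - r : ℝ) : ℂ) + δ * Complex.I := by
      filter_upwards [eventually_gt_nhds h₂] with x hx using gammaPath_of_lt hδ hx
    have hd : HasDerivAt (fun r : ℝ => ((Real.pi * δ / 2 - r : ℝ) : ℂ) + δ * Complex.I) (-1) r := by
      simpa using (((hasDerivAt_id r).const_sub (Real.pi * δ / 2)).ofReal_comp).add_const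
        ((δ : ℂ) * Complex.I)
    rw [he.deriv_eq, hd.deriv, gammaPath_of_lt hδ h₂, gammaTangent, if_pos, if_neg]
    · simp
      linarith
    · simp
      linarith

theorem continuous_gammaTildePath : Continuous (gammaTildePath b) := by
  unfold gammaTildePath
  fun_prop

theorem re_gammaTildePath (r : ℝ) : (gammaTildePath b r).re = b := by simp [gammaTildePath]

theorem re_sq_gammaTildePath (r : ℝ) : ((gammaTildePath b r) ^ 2).re = b ^ 2 - r ^ 2 := by
  rw [sq, Complex.mul_re]
  simp [gammaTildePath]
  ring

theorem deriv_gammaTildePath (r : ℝ) : deriv (gammaTildePath b) r = Complex.I := by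
  have hd : HasDerivAt (gammaTildePath b) Complex.I r := by
    have h := (((hasDerivAt_id r).ofReal_comp).mul_const Complex.I).const_add (b : ℂ)
    rwa [Complex.ofReal_one, one_mul] at h
  exact hd.deriv

theorem measurableSet_range_of_continuous {f : ℝ → ℂ} (hf : Continuous f) :
    MeasurableSet (Set.range f) := by
  obtain ⟨K, hK, hKr⟩ := isSigmaCompact_range hf
  rw [← hKr]
  exact MeasurableSet.iUnion fun n => (hK n).measurableSet

/-! ### Integration with respect to arc length -/

theorem restrict_arcLength_left (hδ : 0 < δ) (hδb : δ < b) :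
    (arcLength δ b).restrict {z | z.re ≤ δ} = (volume : Measure ℝ).map (gammaPath δ) := by
  have hS : MeasurableSet {z : ℂ | z.re ≤ δ} :=
    measurableSet_le Complex.measurable_re measurable_const
  rw [arcLength, Measure.restrict_add, Measure.restrict_eq_self_of_ae_mem,
    Measure.restrict_eq_zero.2, add_zero]
  · rw [Measure.map_apply continuous_gammaTildePath.measurable hS]
    convert! measure_empty (μ := (volume : Measure ℝ))
    ext r
    simp [re_gammaTildePath, hδb]
  · exact (ae_map_iff (p := fun z => z ∈ {z : ℂ | z.re ≤ δ})
      (continuous_gammaPath hδ).measurable.aemeasurable hS).2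
      (Eventually.of_forall fun r => re_gammaPath_le hδ r)

theorem restrict_arcLength_right (hδ : 0 < δ) (hδb : δ < b) :
    (arcLength δ b).restrict {z | b ≤ z.re} = (volume : Measure ℝ).map (gammaTildePath b) := by
  have hS : MeasurableSet {z : ℂ | b ≤ z.re} :=
    measurableSet_le measurable_const Complex.measurable_re
  rw [arcLength, Measure.restrict_add, Measure.restrict_eq_zero.2, zero_add,
    Measure.restrict_eq_self_of_ae_mem]
  · exact (ae_map_iff (p := fun z => z ∈ {z : ℂ | b ≤ z.re})
      continuous_gammaTildePath.measurable.aemeasurable hS).2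
      (Eventually.of_forall fun r => (re_gammaTildePath r).ge)
  · rw [Measure.map_apply (continuous_gammaPath hδ).measurable hS]
    convert! measure_empty (μ := (volume : Measure ℝ))
    ext r
    have := re_gammaPath_le hδ r
    simp
    linarith

/-- Integrals over a part `S` of the contours on which arc length is the image of Lebesgue measure
under a path `p`. -/
theorem integral_eq_integral_path {μ : Measure ℂ} {S : Set ℂ} {p : ℝ → ℂ} (hp : Measurable p)
    (hμ : μ.restrict S = (volume : Measure ℝ).map p) {f : ℂ → ℂ} (hf : AEStronglyMeasurable f μ)
    (hfS : ∀ z, f z ≠ 0 → z ∈ S) : ∫ z, f z ∂μ = ∫ r, f (p r) := by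
  rw [← setIntegral_eq_integral_of_forall_compl_eq_zero (s := S) fun z hz => by
    by_contra h
    exact hz (hfS z h), hμ, integral_map hp.aemeasurable]
  rw [← hμ]
  exact hf.restrict

theorem integrable_comp_path {μ : Measure ℂ} {S : Set ℂ} {p : ℝ → ℂ} (hp : Measurable p)
    (hμ : μ.restrict S = (volume : Measure ℝ).map p) {f : ℂ → ℂ} (hf : Integrable f μ) :
    Integrable fun r => f (p r) := by
  have h : Integrable f ((volume : Measure ℝ).map p) := hμ ▸ hf.restrict
  exact (integrable_map_measure h.aestronglyMeasurable hp.aemeasurable).1 h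

theorem memLp_two_of_path {μ : Measure ℂ} {S : Set ℂ} (hS : MeasurableSet S) {p : ℝ → ℂ}
    (hp : Measurable p) (hμ : μ.restrict S = (volume : Measure ℝ).map p) {f : ℂ → ℂ}
    (hf : Measurable f) (hfS : ∀ z, f z ≠ 0 → z ∈ S) {C κ L : ℝ} (hκ : 0 < κ)
    (hb : ∀ r, ‖f (p r)‖ ≤ C * Real.exp (-κ * r ^ 2 + L * |r|)) : MemLp f 2 μ := by
  have h1 : S.indicator f = f := Set.indicator_eq_self.2 fun z hz => hfS z hz
  rw [← h1, memLp_indicator_iff_restrict hS, hμ, memLp_map_measure_iff hf.aestronglyMeasurable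
    hp.aemeasurable]
  exact memLp_two_of_norm_le_gaussian (hf.comp hp).aestronglyMeasurable hκ hb

end Contours

/-! ### The critical kernel and the integrable kernel -/

section Critical

variable {α δ b a : ℝ}

/-- The factor of `Q_a(x, y) dy` for `x ∈ γ̃` that depends on `y ∈ γ`, without the Cauchy kernel
`1 / (x - y)`. It contains the density `dy / |dy|` and the constant `1 / (2πi)`, and is extended by
zero to `Re z > δ`; off `γ` its values do not matter. -/
def gammaWeight (α δ a : ℝ) : ℂ → ℂ :=
  {z : ℂ | z.re ≤ δ}.indicator fun z => gammaTangent δ z * Complex.Gamma z *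
    Complex.exp (-(α * z ^ 2 / 4) + a * z) / (2 * Real.pi * Complex.I)

/-- The factor `exp (α x² / 4 - a x)` of `Q_a(x, y)` for `x ∈ γ̃`, `y ∈ γ`, cut off to
`Re x ≥ b`. -/
def gammaTildeFactor (α b a : ℝ) : ℂ → ℂ :=
  {z : ℂ | b ≤ z.re}.indicator fun z => Complex.exp (α * z ^ 2 / 4 - a * z)

/-- The factor `exp (-α x² / 4)` of `Q_a(x, y)` for `x ∈ γ`, `y ∈ γ̃`, cut off to `Re x ≤ δ`. -/
def gammaFactor (α δ : ℝ) : ℂ → ℂ :=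
  {z : ℂ | z.re ≤ δ}.indicator fun z => Complex.exp (-(α * z ^ 2 / 4))

/-- The factor of `Q_a(x, y) dy` for `x ∈ γ` that depends on `y ∈ γ̃`, without the Cauchy kernel
`1 / (y - x)`, whose sign absorbs the minus sign in `Q_a`. It contains the density `dy / |dy| = i`
and the constant `1 / (2πi)`. -/
def gammaTildeWeight (α b : ℝ) : ℂ → ℂ :=
  {z : ℂ | b ≤ z.re}.indicator fun z => Complex.I * (Complex.Gamma z)⁻¹ *
    Complex.exp (α * z ^ 2 / 4) / (2 * Real.pi * Complex.I)

theorem measurableSet_re_le (δ : ℝ) : MeasurableSet {z : ℂ | z.re ≤ δ} :=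
  measurableSet_le Complex.measurable_re measurable_const

theorem measurableSet_le_re (b : ℝ) : MeasurableSet {z : ℂ | b ≤ z.re} :=
  measurableSet_le measurable_const Complex.measurable_re

theorem measurable_inv_Gamma : Measurable fun z => (Complex.Gamma z)⁻¹ :=
  Complex.differentiable_one_div_Gamma.continuous.measurable

theorem measurable_Gamma : Measurable Complex.Gamma := by
  have h := measurable_inv_Gamma.inv
  have he : (fun z => (Complex.Gamma z)⁻¹)⁻¹ = Complex.Gamma := by
    funext z
    exact inv_inv _
  rwa [he] at h

theorem re_le_of_gammaWeight_ne_zero {z : ℂ} (hz : gammaWeight α δ a z ≠ 0) : z.re ≤ δ :=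
  Set.mem_of_indicator_ne_zero (s := {z : ℂ | z.re ≤ δ}) hz

theorem le_re_of_gammaTildeFactor_ne_zero {z : ℂ} (hz : gammaTildeFactor α b a z ≠ 0) :
    b ≤ z.re :=
  Set.mem_of_indicator_ne_zero (s := {z : ℂ | b ≤ z.re}) hz

theorem re_le_of_gammaFactor_ne_zero {z : ℂ} (hz : gammaFactor α δ z ≠ 0) : z.re ≤ δ :=
  Set.mem_of_indicator_ne_zero (s := {z : ℂ | z.re ≤ δ}) hz

theorem le_re_of_gammaTildeWeight_ne_zero {z : ℂ} (hz : gammaTildeWeight α b z ≠ 0) :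
    b ≤ z.re :=
  Set.mem_of_indicator_ne_zero (s := {z : ℂ | b ≤ z.re}) hz

instance sFinite_arcLength : SFinite (arcLength δ b) := by
  unfold arcLength
  infer_instance

theorem measurable_gammaWeight : Measurable (gammaWeight α δ a) := by
  have h₁ := measurable_gammaTangent δ
  have h₂ := measurable_Gamma
  exact Measurable.indicator (by fun_prop) (measurableSet_re_le δ)

theorem measurable_gammaTildeFactor : Measurable (gammaTildeFactor α b a) :=
  Measurable.indicator (by fun_prop) (measurableSet_le_re b)

theorem measurable_gammaFactor : Measurable (gammaFactor α δ) :=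
  Measurable.indicator (by fun_prop) (measurableSet_re_le δ)

theorem measurable_gammaTildeWeight : Measurable (gammaTildeWeight α b) := by
  have h := measurable_inv_Gamma
  exact Measurable.indicator (by fun_prop) (measurableSet_le_re b)

theorem norm_two_pi_I : ‖(2 * Real.pi * Complex.I : ℂ)‖ = 2 * Real.pi := by
  simp [abs_of_pos Real.pi_pos]

theorem gammaWeight_gammaPath (hδ : 0 < δ) (r : ℝ) :
    gammaWeight α δ a (gammaPath δ r) = gammaTangent δ (gammaPath δ r) *
      Complex.Gamma (gammaPath δ r) * Complex.exp (-(α * gammaPath δ r ^ 2 / 4) +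
        a * gammaPath δ r) / (2 * Real.pi * Complex.I) :=
  Set.indicator_of_mem (show gammaPath δ r ∈ {z : ℂ | z.re ≤ δ} from re_gammaPath_le hδ r) _

theorem gammaFactor_gammaPath (hδ : 0 < δ) (r : ℝ) :
    gammaFactor α δ (gammaPath δ r) = Complex.exp (-(α * gammaPath δ r ^ 2 / 4)) :=
  Set.indicator_of_mem (show gammaPath δ r ∈ {z : ℂ | z.re ≤ δ} from re_gammaPath_le hδ r) _

theorem gammaTildeFactor_gammaTildePath (r : ℝ) :
    gammaTildeFactor α b a (gammaTildePath b r) =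
      Complex.exp (α * gammaTildePath b r ^ 2 / 4 - a * gammaTildePath b r) :=
  Set.indicator_of_mem
    (show gammaTildePath b r ∈ {z : ℂ | b ≤ z.re} from (re_gammaTildePath r).ge) _

theorem gammaTildeWeight_gammaTildePath (r : ℝ) :
    gammaTildeWeight α b (gammaTildePath b r) = Complex.I *
      (Complex.Gamma (gammaTildePath b r))⁻¹ * Complex.exp (α * gammaTildePath b r ^ 2 / 4) /
        (2 * Real.pi * Complex.I) :=
  Set.indicator_of_mem
    (show gammaTildePath b r ∈ {z : ℂ | b ≤ z.re} from (re_gammaTildePath r).ge) _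

/-- On `γ` the quadratic exponential decays like a Gaussian, also with a linear exponential in
front. -/
theorem norm_exp_gammaPath_le (hα : 0 < α) (hδ : 0 < δ) (a r : ℝ) :
    ‖Complex.exp (-(α * gammaPath δ r ^ 2 / 4) + a * gammaPath δ r)‖ ≤
      Real.exp (α / 4 * ((Real.pi * δ / 2) ^ 2 + δ ^ 2) + |a| * (Real.pi * δ / 2 + δ)) *
        Real.exp (-(α / 8) * r ^ 2 + |a| * |r|) := by
  rw [Complex.norm_exp, ← Real.exp_add, Real.exp_le_exp, Complex.add_re, Complex.neg_re,
    Complex.div_ofNat_re, Complex.re_ofReal_mul, Complex.re_ofReal_mul]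
  have h₁ := mul_le_mul_of_nonneg_left (le_re_sq_gammaPath hδ r) hα.le
  have h₂ : a * (gammaPath δ r).re ≤ |a| * (|r| + (Real.pi * δ / 2 + δ)) :=
    (le_abs_self _).trans (by
      rw [abs_mul]
      exact mul_le_mul_of_nonneg_left (abs_re_gammaPath_le hδ r) (abs_nonneg a))
  linarith

theorem memLp_gammaWeight (hα : 0 < α) (hδ : 0 < δ) (hδb : δ < b) :
    MemLp (gammaWeight α δ a) 2 (arcLength δ b) := by
  obtain ⟨C, L, hC, hL, hΓ⟩ := exists_norm_Gamma_le (M := δ) hδ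
  refine memLp_two_of_path (measurableSet_re_le δ) (continuous_gammaPath hδ).measurable
    (restrict_arcLength_left hδ hδb) measurable_gammaWeight
    (fun z hz => Set.mem_of_indicator_ne_zero hz)
    (C := C * Real.exp (L * (Real.pi * δ / 2 + δ)) * Real.exp (α / 4 *
      ((Real.pi * δ / 2) ^ 2 + δ ^ 2) + |a| * (Real.pi * δ / 2 + δ)) / (2 * Real.pi))
    (κ := α / 8) (L := L + |a|) (by positivity) fun r => ?_
  have h₁ : ‖Complex.Gamma (gammaPath δ r)‖ ≤
      C * (Real.exp (L * |r|) * Real.exp (L * (Real.pi * δ / 2 + δ))) := by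
    refine (hΓ _ (re_gammaPath_le hδ r) (le_norm_gammaPath_add hδ r)).trans ?_
    rw [← Real.exp_add, ← mul_add]
    gcongr
    exact abs_re_gammaPath_le hδ r
  rw [gammaWeight_gammaPath hδ, norm_div, norm_mul, norm_mul, norm_two_pi_I]
  calc _ ≤ 1 * (C * (Real.exp (L * |r|) * Real.exp (L * (Real.pi * δ / 2 + δ)))) *
        (Real.exp (α / 4 * ((Real.pi * δ / 2) ^ 2 + δ ^ 2) + |a| * (Real.pi * δ / 2 + δ)) *
          Real.exp (-(α / 8) * r ^ 2 + |a| * |r|)) / (2 * Real.pi) := by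
        gcongr
        · exact norm_gammaTangent_gammaPath_le hδ r
        · exact norm_exp_gammaPath_le hα hδ a r
    _ = _ := by
        rw [show -(α / 8) * r ^ 2 + (L + |a|) * |r| =
          L * |r| + (-(α / 8) * r ^ 2 + |a| * |r|) by ring, Real.exp_add (L * |r|)]
        ring

theorem memLp_gammaFactor (hα : 0 < α) (hδ : 0 < δ) (hδb : δ < b) :
    MemLp (gammaFactor α δ) 2 (arcLength δ b) := by
  refine memLp_two_of_path (measurableSet_re_le δ) (continuous_gammaPath hδ).measurable
    (restrict_arcLength_left hδ hδb) measurable_gammaFactor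
    (fun z hz => Set.mem_of_indicator_ne_zero hz)
    (C := Real.exp (α / 4 * ((Real.pi * δ / 2) ^ 2 + δ ^ 2) + |0| * (Real.pi * δ / 2 + δ)))
    (κ := α / 8) (L := |0|) (by positivity) fun r => ?_
  have h := norm_exp_gammaPath_le hα hδ 0 r
  rw [gammaFactor_gammaPath hδ]
  simpa only [Complex.ofReal_zero, zero_mul, add_zero] using h

theorem norm_exp_gammaTildePath (r : ℝ) :
    ‖Complex.exp (α * gammaTildePath b r ^ 2 / 4 - a * gammaTildePath b r)‖ =
      Real.exp (α / 4 * b ^ 2 - a * b) * Real.exp (-(α / 4) * r ^ 2) := by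
  rw [Complex.norm_exp, ← Real.exp_add, Complex.sub_re, Complex.div_ofNat_re,
    Complex.re_ofReal_mul, Complex.re_ofReal_mul, re_sq_gammaTildePath, re_gammaTildePath]
  congr 1
  ring

theorem memLp_gammaTildeFactor (hα : 0 < α) (hδ : 0 < δ) (hδb : δ < b) :
    MemLp (gammaTildeFactor α b a) 2 (arcLength δ b) := by
  refine memLp_two_of_path (measurableSet_le_re b) continuous_gammaTildePath.measurable
    (restrict_arcLength_right hδ hδb) measurable_gammaTildeFactor
    (fun z hz => Set.mem_of_indicator_ne_zero hz) (C := Real.exp (α / 4 * b ^ 2 - a * b))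
    (κ := α / 4) (L := 0) (by positivity) fun r => ?_
  rw [gammaTildeFactor_gammaTildePath, norm_exp_gammaTildePath, zero_mul, add_zero]

theorem memLp_gammaTildeWeight (hα : 0 < α) (hδ : 0 < δ) (hδb : δ < b) :
    MemLp (gammaTildeWeight α b) 2 (arcLength δ b) := by
  obtain ⟨C, L, hC, hL, hΓ⟩ := exists_norm_inv_Gamma_le b
  refine memLp_two_of_path (measurableSet_le_re b) continuous_gammaTildePath.measurable
    (restrict_arcLength_right hδ hδb) measurable_gammaTildeWeight
    (fun z hz => Set.mem_of_indicator_ne_zero hz)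
    (C := C * Real.exp (α / 4 * b ^ 2) / (2 * Real.pi))
    (κ := α / 4) (L := L) (by positivity) fun r => ?_
  have h := norm_exp_gammaTildePath (α := α) (b := b) (a := 0) r
  simp only [Complex.ofReal_zero, zero_mul, sub_zero] at h
  rw [gammaTildeWeight_gammaTildePath, norm_div, norm_mul, norm_mul, norm_two_pi_I, h,
    Complex.norm_I, one_mul, Real.exp_add]
  calc _ ≤ C * Real.exp (L * |r|) * (Real.exp (α / 4 * b ^ 2) * Real.exp (-(α / 4) * r ^ 2)) /
        (2 * Real.pi) := by
        gcongr
        exact hΓ r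
    _ = _ := by ring

theorem gammaPath_notMem_gammaTildeSet (hδ : 0 < δ) (hδb : δ < b) (r : ℝ) :
    gammaPath δ r ∉ gammaTildeSet b := by
  rintro ⟨q, hq⟩
  have h₁ := re_gammaPath_le hδ r
  rw [← hq, re_gammaTildePath] at h₁
  linarith

theorem gammaTildePath_notMem_gammaSet (hδ : 0 < δ) (hδb : δ < b) (r : ℝ) :
    gammaTildePath b r ∉ gammaSet δ := by
  rintro ⟨q, hq⟩
  exact gammaPath_notMem_gammaTildeSet hδ hδb q ⟨r, hq.symm⟩

theorem integrableKernel_gammaPath_gammaPath (hδ : 0 < δ) (hδb : δ < b) (q r : ℝ) :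
    integrableKernel α δ b a (gammaPath δ q) (gammaPath δ r) = 0 := by
  simp [integrableKernel, gammaPath_notMem_gammaTildeSet hδ hδb]

theorem integrableKernel_gammaTildePath_gammaTildePath (hδ : 0 < δ) (hδb : δ < b) (q r : ℝ) :
    integrableKernel α δ b a (gammaTildePath b q) (gammaTildePath b r) = 0 := by
  simp [integrableKernel, gammaTildePath_notMem_gammaSet hδ hδb]

theorem integrableKernel_gammaTildePath_gammaPath (hδ : 0 < δ) (hδb : δ < b) (q : ℝ) {r : ℝ}
    (hr : deriv (gammaPath δ) r = gammaTangent δ (gammaPath δ r)) :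
    integrableKernel α δ b a (gammaTildePath b q) (gammaPath δ r) * deriv (gammaPath δ) r =
      gammaTildeFactor α b a (gammaTildePath b q) *
        (gammaWeight α δ a (gammaPath δ r) / (gammaTildePath b q - gammaPath δ r)) := by
  rw [integrableKernel, Set.indicator_of_notMem (gammaTildePath_notMem_gammaSet hδ hδb q),
    Set.indicator_of_mem (show gammaTildePath b q ∈ gammaTildeSet b from ⟨q, rfl⟩),
    Set.indicator_of_mem (show gammaPath δ r ∈ gammaSet δ from ⟨r, rfl⟩),
    gammaTildeFactor_gammaTildePath, gammaWeight_gammaPath hδ, hr]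
  have he : Complex.exp (α * (gammaTildePath b q ^ 2 - gammaPath δ r ^ 2) / 4 -
      a * (gammaTildePath b q - gammaPath δ r)) =
      Complex.exp (α * gammaTildePath b q ^ 2 / 4 - a * gammaTildePath b q) *
        Complex.exp (-(α * gammaPath δ r ^ 2 / 4) + a * gammaPath δ r) := by
    rw [← Complex.exp_add]
    congr 1
    ring
  rw [he, Pi.one_apply, Pi.one_apply]
  simp only [div_eq_mul_inv, mul_inv]
  ring

theorem integrableKernel_gammaPath_gammaTildePath (hδ : 0 < δ) (hδb : δ < b) (q r : ℝ) :
    integrableKernel α δ b a (gammaPath δ q) (gammaTildePath b r) * deriv (gammaTildePath b) r =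
      gammaFactor α δ (gammaPath δ q) *
        (gammaTildeWeight α b (gammaTildePath b r) / (gammaTildePath b r - gammaPath δ q)) := by
  rw [integrableKernel, Set.indicator_of_notMem (gammaPath_notMem_gammaTildeSet hδ hδb q),
    Set.indicator_of_mem (show gammaTildePath b r ∈ gammaTildeSet b from ⟨r, rfl⟩),
    Set.indicator_of_mem (show gammaPath δ q ∈ gammaSet δ from ⟨q, rfl⟩),
    gammaFactor_gammaPath hδ, gammaTildeWeight_gammaTildePath, deriv_gammaTildePath]
  have he : Complex.exp (-(α * (gammaPath δ q ^ 2 - gammaTildePath b r ^ 2) / 4)) =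
      Complex.exp (-(α * gammaPath δ q ^ 2 / 4)) *
        Complex.exp (α * gammaTildePath b r ^ 2 / 4) := by
    rw [← Complex.exp_add]
    congr 1
    ring
  rw [he, Pi.one_apply, Pi.one_apply, ← neg_sub (gammaTildePath b r) (gammaPath δ q)]
  simp only [div_eq_mul_inv, mul_inv, mul_neg, inv_neg]
  ring

theorem integrable_mul_div {μ : Measure ℂ} {w f g : ℂ → ℂ} {ε : ℝ} (hε : 0 < ε)
    (hw : MemLp w 2 μ) (hf : MemLp f 2 μ) (hg : Measurable g)
    (hwg : ∀ z, w z ≠ 0 → ε ≤ ‖g z‖) : Integrable (fun z => w z * f z / g z) μ := by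
  have hi : Integrable (fun z => w z * f z) μ := hw.integrable_mul hf
  refine (hi.norm.const_mul ε⁻¹).mono'
    (hi.aestronglyMeasurable.aemeasurable.div hg.aemeasurable).aestronglyMeasurable
    (Eventually.of_forall fun z => ?_)
  rw [norm_div, div_eq_inv_mul]
  by_cases h : w z = 0
  · simp [h]
  · have := hwg z h
    gcongr

theorem ae_arcLength_of_forall (hδ : 0 < δ) {p : ℂ → Prop}
    (h₁ : ∀ r, p (gammaPath δ r)) (h₂ : ∀ r, p (gammaTildePath b r)) :
    ∀ᵐ x ∂(arcLength δ b), p x := by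
  have hm : MeasurableSet (gammaSet δ ∪ gammaTildeSet b) :=
    (measurableSet_range_of_continuous (continuous_gammaPath hδ)).union
      (measurableSet_range_of_continuous continuous_gammaTildePath)
  have h : ∀ᵐ x ∂(arcLength δ b), x ∈ gammaSet δ ∪ gammaTildeSet b := by
    rw [arcLength, ae_add_measure_iff]
    exact ⟨(ae_map_iff (continuous_gammaPath hδ).measurable.aemeasurable hm).2
        (Eventually.of_forall fun r => Or.inl ⟨r, rfl⟩),
      (ae_map_iff continuous_gammaTildePath.measurable.aemeasurable hm).2
        (Eventually.of_forall fun r => Or.inr ⟨r, rfl⟩)⟩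
  filter_upwards [h] with x hx
  rcases hx with ⟨r, rfl⟩ | ⟨r, rfl⟩
  · exact h₁ r
  · exact h₂ r

theorem le_norm_sub_of_re {x y : ℂ} (hx : x.re ≤ δ) (hy : b ≤ y.re) :
    b - δ ≤ ‖y - x‖ := by
  refine le_trans ?_ ((le_abs_self _).trans (Complex.abs_re_le_norm (y - x)))
  rw [Complex.sub_re]
  linarith

/-- An operator given by two off-diagonal Cauchy-type blocks with these weights is the contour
integral operator with the kernel `Q_a`. -/
theorem isContourIntegralOperator_of_ae (hα : 0 < α) (hδ : 0 < δ) (hδb : δ < b)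
    {Q : ContourL2 δ b →L[ℂ] ContourL2 δ b}
    (hQ : ∀ f : ContourL2 δ b, ∀ᵐ x ∂(arcLength δ b),
      (x.re ≤ δ → Q f x = gammaFactor α δ x *
        ∫ y, gammaTildeWeight α b y * f y / (y - x) ∂(arcLength δ b)) ∧
      (b ≤ x.re → Q f x = gammaTildeFactor α b a x *
        ∫ y, gammaWeight α δ a y * f y / (x - y) ∂(arcLength δ b))) :
    IsContourIntegralOperator δ b (integrableKernel α δ b a) Q := by
  intro f
  have hf := Lp.memLp f
  have hγ := (continuous_gammaPath hδ).measurable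
  have hγ' := (continuous_gammaTildePath (b := b)).measurable
  have key : ∀ᵐ x ∂(arcLength δ b),
      ((x.re ≤ δ → Q f x = gammaFactor α δ x *
        ∫ y, gammaTildeWeight α b y * f y / (y - x) ∂(arcLength δ b)) ∧
      (b ≤ x.re → Q f x = gammaTildeFactor α b a x *
        ∫ y, gammaWeight α δ a y * f y / (x - y) ∂(arcLength δ b))) →
      ContourIntegrable (gammaPath δ) (fun y => integrableKernel α δ b a x y * f y) ∧
      ContourIntegrable (gammaTildePath b) (fun y => integrableKernel α δ b a x y * f y) ∧
      Q f x = contourIntegral (gammaPath δ) (fun y => integrableKernel α δ b a x y * f y)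
        + contourIntegral (gammaTildePath b) (fun y => integrableKernel α δ b a x y * f y) := by
    refine ae_arcLength_of_forall hδ (fun q => ?_) (fun q => ?_)
    · rintro ⟨h, -⟩
      have hx := re_gammaPath_le hδ q
      have hi : Integrable (fun y => gammaTildeWeight α b y * f y / (y - gammaPath δ q))
          (arcLength δ b) :=
        integrable_mul_div (sub_pos.2 hδb) (memLp_gammaTildeWeight hα hδ hδb) hf (by fun_prop)
          fun z hz => le_norm_sub_of_re hx (le_re_of_gammaTildeWeight_ne_zero hz)
      have h0 : (fun r => integrableKernel α δ b a (gammaPath δ q) (gammaPath δ r) *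
          f (gammaPath δ r) * deriv (gammaPath δ) r) = fun _ => 0 := by
        funext r
        rw [integrableKernel_gammaPath_gammaPath hδ hδb, zero_mul, zero_mul]
      have h1 : (fun r => integrableKernel α δ b a (gammaPath δ q) (gammaTildePath b r) *
          f (gammaTildePath b r) * deriv (gammaTildePath b) r) = fun r =>
            gammaFactor α δ (gammaPath δ q) * (gammaTildeWeight α b (gammaTildePath b r) *
              f (gammaTildePath b r) / (gammaTildePath b r - gammaPath δ q)) := by
        funext r
        rw [mul_right_comm, integrableKernel_gammaPath_gammaTildePath hδ hδb]
        ring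
      refine ⟨?_, ?_, ?_⟩
      · rw [ContourIntegrable, h0]
        exact integrable_zero _ _ _
      · rw [ContourIntegrable, h1]
        exact (integrable_comp_path hγ' (restrict_arcLength_right hδ hδb) hi).const_mul _
      · rw [h hx, contourIntegral, contourIntegral, h0, h1, integral_zero, zero_add,
          integral_const_mul, integral_eq_integral_path hγ' (restrict_arcLength_right hδ hδb)
            hi.aestronglyMeasurable fun z hz => ?_]
        exact le_re_of_gammaTildeWeight_ne_zero (left_ne_zero_of_mul (div_ne_zero_iff.1 hz).1)
    · rintro ⟨-, h⟩
      have hx : b ≤ (gammaTildePath b q).re := (re_gammaTildePath q).ge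
      have hi : Integrable (fun y => gammaWeight α δ a y * f y / (gammaTildePath b q - y))
          (arcLength δ b) :=
        integrable_mul_div (sub_pos.2 hδb) (memLp_gammaWeight hα hδ hδb) hf (by fun_prop)
          fun z hz => le_norm_sub_of_re (re_le_of_gammaWeight_ne_zero hz) hx
      have h0 : (fun r => integrableKernel α δ b a (gammaTildePath b q) (gammaTildePath b r) *
          f (gammaTildePath b r) * deriv (gammaTildePath b) r) = fun _ => 0 := by
        funext r
        rw [integrableKernel_gammaTildePath_gammaTildePath hδ hδb, zero_mul, zero_mul]
      have h1 : (fun r => integrableKernel α δ b a (gammaTildePath b q) (gammaPath δ r) *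
          f (gammaPath δ r) * deriv (gammaPath δ) r) =ᵐ[volume] fun r =>
            gammaTildeFactor α b a (gammaTildePath b q) * (gammaWeight α δ a (gammaPath δ r) *
              f (gammaPath δ r) / (gammaTildePath b q - gammaPath δ r)) := by
        filter_upwards [deriv_gammaPath_ae hδ] with r hr
        rw [mul_right_comm, integrableKernel_gammaTildePath_gammaPath hδ hδb q hr]
        ring
      refine ⟨?_, ?_, ?_⟩
      · rw [ContourIntegrable, integrable_congr h1]
        exact (integrable_comp_path hγ (restrict_arcLength_left hδ hδb) hi).const_mul _
      · rw [ContourIntegrable, h0]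
        exact integrable_zero _ _ _
      · rw [h hx, contourIntegral, contourIntegral, h0, integral_congr_ae h1, integral_zero,
          add_zero, integral_const_mul, integral_eq_integral_path hγ
            (restrict_arcLength_left hδ hδb) hi.aestronglyMeasurable fun z hz => ?_]
        exact re_le_of_gammaWeight_ne_zero (left_ne_zero_of_mul (div_ne_zero_iff.1 hz).1)
  filter_upwards [hQ f, key] with x h₁ h₂ using h₂ h₁

theorem critKernel_eq_integral (hδ : 0 < δ) (hδb : δ < b) (a x y : ℝ) :
    critKernel α δ b x y =
      ∫ s, gammaTildeWeight α b s * gammaTildeFactor α b a s *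
        Complex.exp (-((y - a : ℝ) : ℂ) * s) *
          ∫ t, gammaWeight α δ a t * gammaFactor α δ t * Complex.exp (((x - a : ℝ) : ℂ) * t) /
            (s - t) ∂(arcLength δ b) ∂(arcLength δ b) := by
  have hγ := (continuous_gammaPath hδ).measurable
  have hγ' := (continuous_gammaTildePath (b := b)).measurable
  have m₁ := measurable_gammaWeight (α := α) (δ := δ) (a := a)
  have m₂ := measurable_gammaTildeFactor (α := α) (b := b) (a := a)
  have m₃ := measurable_gammaFactor (α := α) (δ := δ)
  have m₄ := measurable_gammaTildeWeight (α := α) (b := b)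
  have hin : StronglyMeasurable fun s : ℂ => ∫ t, gammaWeight α δ a t * gammaFactor α δ t *
      Complex.exp (((x - a : ℝ) : ℂ) * t) / (s - t) ∂(arcLength δ b) := by
    refine StronglyMeasurable.integral_prod_right (f := fun s t => gammaWeight α δ a t *
      gammaFactor α δ t * Complex.exp (((x - a : ℝ) : ℂ) * t) / (s - t)) ?_
    refine Measurable.stronglyMeasurable ?_
    unfold Function.uncurry
    fun_prop
  have hout : Measurable fun s : ℂ => gammaTildeWeight α b s * gammaTildeFactor α b a s *
      Complex.exp (-((y - a : ℝ) : ℂ) * s) *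
        ∫ t, gammaWeight α δ a t * gammaFactor α δ t * Complex.exp (((x - a : ℝ) : ℂ) * t) /
          (s - t) ∂(arcLength δ b) :=
    Measurable.mul (by fun_prop) hin.measurable
  rw [integral_eq_integral_path hγ' (restrict_arcLength_right hδ hδb)
    hout.aestronglyMeasurable fun z hz => le_re_of_gammaTildeWeight_ne_zero
      (left_ne_zero_of_mul (left_ne_zero_of_mul (left_ne_zero_of_mul hz))),
    critKernel, contourIntegral, ← integral_const_mul]
  congr 1
  funext r
  rw [integral_eq_integral_path hγ (restrict_arcLength_left hδ hδb)
    (by fun_prop : Measurable fun t => gammaWeight α δ a t * gammaFactor α δ t *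
      Complex.exp (((x - a : ℝ) : ℂ) * t) / (gammaTildePath b r - t)).aestronglyMeasurable
    fun z hz => re_le_of_gammaWeight_ne_zero (left_ne_zero_of_mul (left_ne_zero_of_mul
      (div_ne_zero_iff.1 hz).1)), contourIntegral,
    ← integral_mul_const, ← integral_const_mul, ← integral_const_mul, deriv_gammaTildePath]
  refine integral_congr_ae ?_
  filter_upwards [deriv_gammaPath_ae hδ] with q hq
  rw [hq, gammaWeight_gammaPath hδ, gammaFactor_gammaPath hδ, gammaTildeFactor_gammaTildePath,
    gammaTildeWeight_gammaTildePath]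
  have h₁ : Complex.exp (α * gammaTildePath b r ^ 2 / 2 - y * gammaTildePath b r) =
      Complex.exp (α * gammaTildePath b r ^ 2 / 4) *
        Complex.exp (α * gammaTildePath b r ^ 2 / 4 - a * gammaTildePath b r) *
        Complex.exp (-((y - a : ℝ) : ℂ) * gammaTildePath b r) := by
    rw [← Complex.exp_add, ← Complex.exp_add]
    congr 1
    push_cast
    ring
  have h₂ : (Complex.exp (α * gammaPath δ q ^ 2 / 2 - x * gammaPath δ q))⁻¹ =
      Complex.exp (-(α * gammaPath δ q ^ 2 / 4) + a * gammaPath δ q) *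
        Complex.exp (-(α * gammaPath δ q ^ 2 / 4)) *
        Complex.exp (((x - a : ℝ) : ℂ) * gammaPath δ q) := by
    rw [← Complex.exp_neg, ← Complex.exp_add, ← Complex.exp_add]
    congr 1
    push_cast
    ring
  rw [div_eq_mul_inv (Complex.exp (α * gammaTildePath b r ^ 2 / 2 - y * gammaTildePath b r)),
    h₁, h₂]
  simp only [div_eq_mul_inv, mul_inv, one_mul]
  ring

end Critical

end

theorem theorem6p1 (α : ℝ) (hα : 0 < α) (δ b : ℝ) (hδ : 0 < δ) (hδb : δ < b)
    (a : ℝ) (ha : 0 < a) :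
    ∃ (Q : ContourL2 δ b →L[ℂ] ContourL2 δ b) (d : ℂ),
      IsContourIntegralOperator δ b (integrableKernel α δ b a) Q ∧
      HasFredholmDet Q d ∧
      HasFredholmSeries (critKernel α δ b) a d ∧
      ∀ {Ω : Type*} [MeasurableSpace Ω] (P : Measure Ω) [IsProbabilityMeasure P] (X : Ω → Set ℝ),
        IsDeterminantalProcess P X (critKernel α δ b) → (gapProbability P X a : ℂ) = d := by
  obtain ⟨Q, d, hQ, hdet, hK⟩ := exists_hasFredholmDet_twoContour (μ := arcLength δ b) hδb a
    (memLp_gammaWeight (a := a) hα hδ hδb) (memLp_gammaTildeFactor (a := a) hα hδ hδb)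
    (memLp_gammaFactor hα hδ hδb) (memLp_gammaTildeWeight hα hδ hδb) measurable_gammaWeight
    measurable_gammaTildeFactor measurable_gammaFactor measurable_gammaTildeWeight
    (fun _ => re_le_of_gammaWeight_ne_zero) (fun _ => le_re_of_gammaTildeFactor_ne_zero)
    (fun _ => re_le_of_gammaFactor_ne_zero) (fun _ => le_re_of_gammaTildeWeight_ne_zero)
  have hseries := hK (critKernel α δ b) fun x y _ _ => critKernel_eq_integral hδ hδb a x y
  exact ⟨Q, d, isContourIntegralOperator_of_ae hα hδ hδb hQ, hdet, hseries,
    fun P _ X hX => gapProbability_eq_of_hasFredholmSeries hseries P X hX⟩
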